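/- Let $d\ge 1$, $\alpha\in(1,2]$, and write $z=(x,v)\in\mathbb R^d\times\mathbb R^d=\mathbb R^{2d}$, $\boldsymbol a=(1+\alpha,1)$, $|z|_{\boldsymbol a}=|x|^{1/(1+\alpha)}+|v|$. For $\boldsymbol p=(p_x,p_v)\in[1,\infty]^2$ let $\|f\|_{\boldsymbol p}=\big\|v\mapsto\|f(\cdot,v)\|_{L^{p_x}(\mathbb R^d)}\big\|_{L^{p_v}(\mathbb R^d)}$, and put $\mathcal A_{\boldsymbol p,\boldsymbol r}=(1+\alpha)d\big(\tfrac1{p_x}-\tfrac1{r_x}\big)+d\big(\tfrac1{p_v}-\tfrac1{r_v}\big)$, $\boldsymbol 1=(1,1)$; inequalities between pairs are componentwise. Fix a symmetric $C^\infty$ function $\chi_0:\mathbb R^{2d}\to\mathbb R$ with $\chi_0(\xi)=1$ for $|\xi|_{\boldsymbol a}\le1$ and $\chi_0(\xi)=0$ for $|\xi|_{\boldsymbol a}>2$. With $2^{s\boldsymbol a}(\xi_1,\xi_2)=(2^{(1+\alpha)s}\xi_1,2^s\xi_2)$ let $\phi_0^{\boldsymbol a}=\chi_0$ and $\phi_j^{\boldsymbol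 a}(\xi)=\chi_0(2^{-j\boldsymbol a}\xi)-\chi_0(2^{-(j-1)\boldsymbol a}\xi)$ for $j\ge1$. For a tempered distribution $f$ let $\mathcal R_j^{\boldsymbol a}f=\check\phi_j^{\boldsymbol a}*f$, where $\check g(z)=(2\pi)^{-2d}\int e^{i\xi\cdot z}g(\xi)\,d\xi$, and $\|f\|_{\mathbf B^{s,1}_{\boldsymbol p;\boldsymbol a}}=\sum_{j\ge0}2^{js}\|\mathcal R^{\boldsymbol a}_jf\|_{\boldsymbol p}$. For a real Schwartz function $\phi$ on $\mathbb R^{2d}$ and $\lambda>0$ let $\phi_\lambda(x,v)=\lambda^{(2+\alpha)d}\phi(\lambda^{1+\alpha}x,\lambda v)$. Theorem C.3. Let $\phi$ be a real Schwartz function on $\mathbb R^{2d}$, let $\boldsymbol p_1\in[1,\infty)^2$ and $\boldsymbol p=(p_x,p_v)\in(1,\infty)^2$ with $\boldsymbol p_1\le\boldsymbol p$, and put $q=p_x\wedge p_v\wedge2$. If $\boldsymbol p_1=\boldsymbol p$ let $\ell=0$; otherwise let $\ell>\mathcal A_{\boldsymbol p_1,\boldsymbol p}$. Let $\beta<0$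 and let $m>1$ be an integer. Then there is a constant $C>0$, depending only on $d,\alpha,\chi_0,\phi,\boldsymbol p_1,\boldsymbol p,\ell,\beta,m$, such that for every probability measure $\mu$ on $\mathbb R^{2d}$ with $\int|z|_{\boldsymbol a}^{\ell m}\mu(dz)<\infty$, every $N\ge1$, all i.i.d. random variables $\xi_1,\dots,\xi_N$ in $\mathbb R^{2d}$ with law $\mu$ and empirical measure $\bar\mu_N=\frac1N\sum_{i=1}^N\delta_{\xi_i}$, and every real $\lambda\ge1$, the random variable $\|\phi_\lambda*(\bar\mu_N-\mu)\|_{\mathbf B^{\beta,1}_{\boldsymbol p_1;\boldsymbol a}}$ is measurable and $$\Big(\mathbb E\,\|\phi_\lambda*(\bar\mu_N-\mu)\|_{\mathbf B^{\beta,1}_{\boldsymbol p_1;\boldsymbol a}}^m\Big)^{1/m}\le C\,\big(1+\mathbb E|\xi_1|_{\boldsymbol a}^{\ell m}\big)^{1/m}\,N^{\frac1q-1}\,\lambda^{\mathcal A_{\boldsymbol 1,\boldsymbol p}}.$$ -/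

import Mathlib

open MeasureTheory ProbabilityTheory
open scoped ENNReal NNReal SchwartzMap FourierTransform

noncomputable section

namespace AnisoBesov

/-- The phase space `ℝ^{2d} = ℝ^d × ℝ^d`, with points `z = (x, v)` and the Euclidean structure. -/
abbrev Phase (d : ℕ) : Type :=
  WithLp 2 (EuclideanSpace ℝ (Fin d) × EuclideanSpace ℝ (Fin d))

/-- The anisotropic size `|z|_a = |x|^{1/(1+α)} + |v|` of `z = (x, v)`, where `a = (1+α, 1)`. -/
def anorm {d : ℕ} (α : ℝ) (z : Phase d) : ℝ :=
  ‖z.fst‖ ^ (1 / (1 + α)) + ‖z.snd‖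

/-- The quantity `𝒜_{p,q} = (1+α)d(1/p_x - 1/q_x) + d(1/p_v - 1/q_v)` for
`p = (p_x, p_v)` and `q = (q_x, q_v)` in `[1,∞]²`. -/
def gap (d : ℕ) (α : ℝ) (p q : ℝ≥0∞ × ℝ≥0∞) : ℝ :=
  (1 + α) * d * ((p.1⁻¹).toReal - (q.1⁻¹).toReal) + d * ((p.2⁻¹).toReal - (q.2⁻¹).toReal)

/-- The mixed Lebesgue norm `‖f‖_p`: the `L^{p_v}` norm in `v` of the `L^{p_x}` norm in `x`. -/
def mixedNorm {d : ℕ} (p : ℝ≥0∞ × ℝ≥0∞) (f : Phase d → ℂ) : ℝ≥0∞ :=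
  eLpNorm (fun v : EuclideanSpace ℝ (Fin d) =>
    eLpNorm (fun x : EuclideanSpace ℝ (Fin d) => f (WithLp.toLp 2 (x, v))) p.1 volume) p.2 volume

/-- The linear automorphism `(x, v) ↦ (a x, b v)` for `a, b ≠ 0`. -/
def scaleBy (d : ℕ) (a b : ℝ) (ha : a ≠ 0) (hb : b ≠ 0) : Phase d ≃L[ℝ] Phase d :=
  { toFun := fun z => WithLp.toLp 2 (a • z.fst, b • z.snd)
    invFun := fun z => WithLp.toLp 2 (a⁻¹ • z.fst, b⁻¹ • z.snd)
    map_add' := fun z w => by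
      simp only [WithLp.add_fst, WithLp.add_snd, smul_add]; rfl
    map_smul' := fun c z => by
      simp only [WithLp.smul_fst, WithLp.smul_snd, smul_comm _ c, RingHom.id_apply]; rfl
    left_inv := fun z => by
      change WithLp.toLp 2 (a⁻¹ • a • z.fst, b⁻¹ • b • z.snd) = z
      rw [inv_smul_smul₀ ha, inv_smul_smul₀ hb]; rfl
    right_inv := fun z => by
      change WithLp.toLp 2 (a • a⁻¹ • z.fst, b • b⁻¹ • z.snd) = z
      rw [smul_inv_smul₀ ha, smul_inv_smul₀ hb]; rfl
    continuous_toFun := by fun_prop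
    continuous_invFun := by fun_prop }

/-- The anisotropic scaling `2^{s a} ξ = (2^{(1+α)s} ξ₁, 2^s ξ₂)`. -/
def dyadicScale (d : ℕ) (α s : ℝ) : Phase d ≃L[ℝ] Phase d :=
  scaleBy d ((2 : ℝ) ^ ((1 + α) * s)) ((2 : ℝ) ^ s) (by positivity) (by positivity)

/-- A symmetric smooth cut-off `χ₀` which is `1` on `{|ξ|_a ≤ 1}` and `0` outside `{|ξ|_a ≤ 2}`.
(A smooth function with the last property has compact support, hence is a Schwartz function;
it is bundled as such.) -/
structure Cutoff (d : ℕ) (α : ℝ) where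
  /-- the cut-off function -/
  fn : 𝓢(Phase d, ℝ)
  symm : ∀ ξ, fn (-ξ) = fn ξ
  eq_one : ∀ ξ, anorm α ξ ≤ 1 → fn ξ = 1
  eq_zero : ∀ ξ, 2 < anorm α ξ → fn ξ = 0

/-- The dyadic partition of unity: `φ_0 = χ₀` and
`φ_j(ξ) = χ₀(2^{-j a} ξ) - χ₀(2^{-(j-1) a} ξ)` for `j ≥ 1`. -/
def Cutoff.piece {d : ℕ} {α : ℝ} (χ : Cutoff d α) : ℕ → 𝓢(Phase d, ℝ)
  | 0 => χ.fn
  | j + 1 =>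
      SchwartzMap.compCLMOfContinuousLinearEquiv ℝ (dyadicScale d α (-((j : ℝ) + 1))) χ.fn -
        SchwartzMap.compCLMOfContinuousLinearEquiv ℝ (dyadicScale d α (-(j : ℝ))) χ.fn

/-- The inverse Fourier transform `ǧ(z) = (2π)^{-2d} ∫ e^{i ξ·z} g(ξ) dξ` of a real Schwartz
function, written as the (unitary-frequency) transform `∫ e^{2π i η·z} g(2πη) dη`. -/
def invFourier {d : ℕ} (g : 𝓢(Phase d, ℝ)) : 𝓢(Phase d, ℂ) :=
  𝓕⁻ (SchwartzMap.postcompCLM Complex.ofRealCLM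
    (SchwartzMap.compCLMOfContinuousLinearEquiv ℝ
      (scaleBy d (2 * Real.pi) (2 * Real.pi) (by positivity) (by positivity)) g))

theorem invFourier_apply {d : ℕ} (g : 𝓢(Phase d, ℝ)) (z : Phase d) :
    invFourier g z = (((2 * Real.pi) ^ (2 * d))⁻¹ : ℝ) •
      ∫ ξ : Phase d, Complex.exp (Complex.I * (inner ℝ ξ z : ℝ)) * (g ξ : ℂ) := by
  have h := Measure.integral_comp_smul (volume : Measure (Phase d))
    (fun ξ => Complex.exp (Complex.I * (inner ℝ ξ z : ℝ)) * (g ξ : ℂ)) (2 * Real.pi)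
  have hr : Module.finrank ℝ (Phase d) = 2 * d := by
    rw [(WithLp.linearEquiv 2 ℝ _).finrank_eq]; simp; ring
  rw [hr, abs_of_nonneg (by positivity)] at h
  rw [← h]
  unfold invFourier
  rw [SchwartzMap.fourierInv_coe, Real.fourierInv_eq]
  congr 1; ext ξ
  rw [Circle.smul_def, smul_eq_mul]
  congr 1
  · rw [Real.fourierChar_apply, real_inner_smul_left]; congr 1; push_cast; ring

/-- The test function `y ↦ g(z - y)`. -/
def reflectAt {d : ℕ} (g : 𝓢(Phase d, ℂ)) (z : Phase d) : 𝓢(Phase d, ℂ) :=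
  SchwartzMap.compSubConstCLM ℂ z
    (SchwartzMap.compCLMOfContinuousLinearEquiv ℂ (ContinuousLinearEquiv.neg ℝ) g)

/-- The dyadic block `ℛ_j f = φ̌_j * f` of a tempered distribution `f`, i.e. the function
`z ↦ ⟨f, φ̌_j(z - ·)⟩`. -/
def Cutoff.block {d : ℕ} {α : ℝ} (χ : Cutoff d α) (j : ℕ) (f : 𝓢'(Phase d, ℂ))
    (z : Phase d) : ℂ :=
  f (reflectAt (invFourier (χ.piece j)) z)

/-- The anisotropic Besov norm
`‖f‖_{B^{s,q}_{p;a}} = (∑_{j ≥ 0} (2^{js} ‖ℛ_j f‖_p)^q)^{1/q}` (supremum over `j` if `q = ∞`). -/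
def Cutoff.besovNorm {d : ℕ} {α : ℝ} (χ : Cutoff d α) (s : ℝ) (q : ℝ≥0∞) (p : ℝ≥0∞ × ℝ≥0∞)
    (f : 𝓢'(Phase d, ℂ)) : ℝ≥0∞ :=
  eLpNorm (fun j : ℕ => ENNReal.ofReal ((2 : ℝ) ^ ((j : ℝ) * s)) * mixedNorm p (χ.block j f)) q
    Measure.count

/-- The dilation `φ_λ(x, v) = λ^{(2+α)d} φ(λ^{1+α} x, λ v)`. -/
def dilate {d : ℕ} (α lam : ℝ) (φ : Phase d → ℝ) (z : Phase d) : ℝ :=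
  lam ^ ((2 + α) * d) * φ (WithLp.toLp 2 (lam ^ (1 + α) • z.fst, lam • z.snd))

/-- The convolution `(f * ν)(z) = ∫ f(z - y) ν(dy)` of a function with a measure. -/
def conv {d : ℕ} (f : Phase d → ℝ) (ν : Measure (Phase d)) (z : Phase d) : ℝ :=
  ∫ y, f (z - y) ∂ν

/-- The empirical measure `N⁻¹ ∑_i δ_{x_i}`. -/
def empirical {d N : ℕ} (x : Fin N → Phase d) : Measure (Phase d) :=
  ((N : ℝ≥0)⁻¹) • ∑ i, Measure.dirac (x i)

instance {d N : ℕ} (x : Fin N → Phase d) : IsFiniteMeasure (empirical x) := by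
  unfold empirical; infer_instance

theorem memLp_conv {d : ℕ} (α lam : ℝ) (φ : 𝓢(Phase d, ℝ)) (ν : Measure (Phase d))
    [IsFiniteMeasure ν] : MemLp (conv (dilate α lam φ) ν) ∞ volume := by
  obtain ⟨K, hK⟩ : ∃ K, ∀ z, ‖φ z‖ ≤ K := by
    obtain ⟨K, -, hK⟩ := φ.decay 0 0
    exact ⟨K, fun z => by simpa using hK z⟩
  have hc : Continuous (dilate α lam φ) := by
    unfold dilate
    refine continuous_const.mul (φ.continuous.comp ?_)
    fun_prop
  have hb : ∀ z, ‖dilate α lam φ z‖ ≤ ‖lam ^ ((2 + α) * (d : ℝ))‖ * K := fun z => by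
    rw [dilate, norm_mul]
    gcongr
    exact hK _
  have hcont : Continuous (conv (dilate α lam φ) ν) := by
    unfold conv
    refine continuous_of_dominated (bound := fun _ => ‖lam ^ ((2 + α) * (d : ℝ))‖ * K)
      (fun z => ?_) (fun z => .of_forall fun y => hb _) (integrable_const _)
      (.of_forall fun y => by fun_prop)
    exact (hc.comp (continuous_const.sub continuous_id)).aestronglyMeasurable
  refine memLp_top_of_bound hcont.aestronglyMeasurable
    ((‖lam ^ ((2 + α) * (d : ℝ))‖ * K) * ν.real Set.univ) (.of_forall fun z => ?_)
  exact norm_integral_le_of_norm_le_const (.of_forall fun y => hb _)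

/-- The tempered distribution `φ_λ * (ν - μ)`: integration against the bounded continuous
function `z ↦ ∫ φ_λ(z - y) ν(dy) - ∫ φ_λ(z - y) μ(dy)`. -/
def mollifiedDiff {d : ℕ} (α lam : ℝ) (φ : 𝓢(Phase d, ℝ)) (ν μ : Measure (Phase d))
    [IsFiniteMeasure ν] [IsFiniteMeasure μ] : 𝓢'(Phase d, ℂ) :=
  Lp.toTemperedDistribution
    ((((memLp_conv α lam φ ν).sub (memLp_conv α lam φ μ)).ofReal (K := ℂ)).toLp
      (fun z => ((conv (dilate α lam φ) ν z - conv (dilate α lam φ) μ z : ℝ) : ℂ)))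

end AnisoBesov

end

open AnisoBesov

/-!
The centred empirical measure is a sum of independent fields with values in a mixed Lebesgue space.
Symmetrization and Khintchine's inequality, combined with Minkowski's inequality for iterated norms,
show that `L^p` has type `q = p_x ∧ p_v ∧ 2`; hence `N` centred summands cost a factor `N^{1/q}`,
which becomes `N^{1/q - 1}` after averaging. The norm exponent is raised from `p₁` to `p` with a
weight of order `ℓ > 𝒜_{p₁,p}`, by Hölder's inequality; the weight is submultiplicative, so moving
the field to the sample point `ξ₁` produces the moment of `|ξ₁|_a`. The kernel of each block is
`φ̌_j * φ_λ`: the weighted `L¹` norms of `φ̌_j` are bounded uniformly in `j` by anisotropic scaling,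
so Young's inequality reduces its weighted `L^p` norm to that of `φ_λ`, which scales like
`λ^{𝒜_{1,p}}`. Since `β < 0`, the sum over `j` is a convergent geometric series.
-/

noncomputable section

namespace AnisoBesov

section LpNorm

variable {X Y ε : Type*} [MeasurableSpace X] [MeasurableSpace Y] {p q : ℝ≥0∞}
  {μ : Measure X} {ν : Measure Y}

theorem measurable_eLpNorm_left [TopologicalSpace ε] [ContinuousENorm ε] [MeasurableSpace ε]
    [OpensMeasurableSpace ε] [SFinite μ] (hp : p ≠ ∞) {F : X → Y → ε}
    (hF : Measurable (Function.uncurry F)) : Measurable fun y => eLpNorm (fun x => F x y) p μ := by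
  rcases eq_or_ne p 0 with rfl | hp0
  · simp
  simp only [eLpNorm_eq_lintegral_rpow_enorm_toReal hp0 hp]
  exact (Measurable.lintegral_prod_left (hF.enorm.pow_const p.toReal)).pow_const _

theorem measurable_eLpNorm_right [TopologicalSpace ε] [ContinuousENorm ε] [MeasurableSpace ε]
    [OpensMeasurableSpace ε] [SFinite ν] (hp : p ≠ ∞) {F : X → Y → ε}
    (hF : Measurable (Function.uncurry F)) : Measurable fun x => eLpNorm (F x) p ν :=
  measurable_eLpNorm_left hp (F := fun y x => F x y) (hF.comp measurable_swap)

theorem eLpNorm_const_mul_ennreal (c : ℝ≥0∞) {f : X → ℝ≥0∞} (hf : AEMeasurable f μ) :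
    eLpNorm (fun x => c * f x) p μ = c * eLpNorm f p μ := by
  rcases eq_or_ne p 0 with rfl | hp0
  · simp
  rcases eq_or_ne p ∞ with rfl | hp
  · exact ENNReal.essSup_const_mul
  have hp' : 0 < p.toReal := ENNReal.toReal_pos hp0 hp
  simp only [eLpNorm_eq_lintegral_rpow_enorm_toReal hp0 hp, enorm_eq_self,
    ENNReal.mul_rpow_of_nonneg _ _ hp'.le]
  rw [lintegral_const_mul'' _ (hf.pow_const _), ENNReal.mul_rpow_of_nonneg _ _ (by positivity),
    ← ENNReal.rpow_mul, mul_one_div_cancel hp'.ne', ENNReal.rpow_one]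

theorem eLpNorm_prod [TopologicalSpace ε] [ContinuousENorm ε] [MeasurableSpace ε]
    [OpensMeasurableSpace ε] [SFinite ν] (hp : p ≠ ∞) {f : X × Y → ε}
    (hf : Measurable f) :
    eLpNorm f p (μ.prod ν) = eLpNorm (fun x => eLpNorm (fun y => f (x, y)) p ν) p μ := by
  rcases eq_or_ne p 0 with rfl | hp0
  · simp
  have hp' : p.toReal ≠ 0 := (ENNReal.toReal_pos hp0 hp).ne'
  simp only [eLpNorm_eq_lintegral_rpow_enorm_toReal hp0 hp, enorm_eq_self, ← ENNReal.rpow_mul,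
    one_div_mul_cancel hp', ENNReal.rpow_one,
    lintegral_prod _ (hf.enorm.pow_const p.toReal).aemeasurable]

/-- The dual form of Minkowski's integral inequality: Fubini and Hölder in `x`. -/
theorem lintegral_lintegral_mul_le [SFinite μ] [SFinite ν] {r s : ℝ} (hrs : r.HolderConjugate s)
    {F : X → Y → ℝ≥0∞} (hF : Measurable (Function.uncurry F)) {g : X → ℝ≥0∞} (hg : Measurable g) :
    ∫⁻ x, (∫⁻ y, F x y ∂ν) * g x ∂μ ≤
      (∫⁻ y, eLpNorm' (fun x => F x y) r μ ∂ν) * eLpNorm' g s μ := by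
  have hFx (x : X) : Measurable (F x) := hF.comp measurable_prodMk_left
  have hFy (y : Y) : Measurable fun x => F x y := hF.comp measurable_prodMk_right
  calc ∫⁻ x, (∫⁻ y, F x y ∂ν) * g x ∂μ
      = ∫⁻ x, ∫⁻ y, F x y * g x ∂ν ∂μ := by simp only [lintegral_mul_const _ (hFx _)]
    _ = ∫⁻ y, ∫⁻ x, F x y * g x ∂μ ∂ν :=
        lintegral_lintegral_swap (hF.mul (hg.comp measurable_fst)).aemeasurable
    _ ≤ ∫⁻ y, eLpNorm' (fun x => F x y) r μ * eLpNorm' g s μ ∂ν :=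
        lintegral_mono fun y =>
          ENNReal.lintegral_mul_le_Lp_mul_Lq μ hrs (hFy y).aemeasurable hg.aemeasurable
    _ = _ := by
        refine lintegral_mul_const _ ?_
        exact (Measurable.lintegral_prod_left (hF.pow_const r)).pow_const _

theorem rpow_one_div_le_of_le_mul_rpow {r s : ℝ} (hrs : r.HolderConjugate s) {A T : ℝ≥0∞}
    (hA : A ≠ ∞) (h : A ≤ T * A ^ (1 / s)) : A ^ (1 / r) ≤ T := by
  rcases eq_or_ne A 0 with rfl | hA0
  · simp [hrs.pos]
  have hs : A ^ (1 / s) ≠ 0 := by simp [hA0, hA]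
  have hs' : A ^ (1 / s) ≠ ∞ := by finiteness
  rw [← ENNReal.mul_le_mul_iff_left hs hs', ← ENNReal.rpow_add _ _ hA0 hA]
  simpa only [one_div, hrs.inv_add_inv_eq_one, ENNReal.rpow_one] using h

theorem exists_simpleFunc_lintegral_lt_top_of_lt_lintegral [SigmaFinite μ] {f : X → ℝ≥0∞}
    {L : ℝ≥0∞} (hL : L < ∫⁻ x, f x ∂μ) :
    ∃ h : SimpleFunc X ℝ≥0, (∀ x, h x ≤ f x) ∧ ∫⁻ x, h x ∂μ < ∞ ∧ L < ∫⁻ x, h x ∂μ := by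
  rw [lintegral_eq_nnreal] at hL
  simp only [lt_iSup_iff] at hL
  obtain ⟨g, hgf, hLg⟩ := hL
  rw [← SimpleFunc.lintegral_eq_lintegral] at hLg
  obtain ⟨h, hhg, hfin, hLh⟩ := SimpleFunc.exists_lt_lintegral_simpleFunc_of_lt_lintegral hLg
  exact ⟨h, fun x => (ENNReal.coe_le_coe.2 (hhg x)).trans (hgf x), hfin, hLh⟩

theorem eLpNorm_lintegral_le [SigmaFinite μ] [SFinite ν] (hp : 1 ≤ p) (hp' : p ≠ ∞)
    {F : X → Y → ℝ≥0∞} (hF : Measurable (Function.uncurry F)) :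
    eLpNorm (fun x => ∫⁻ y, F x y ∂ν) p μ ≤ ∫⁻ y, eLpNorm (fun x => F x y) p μ ∂ν := by
  rcases hp.eq_or_lt with rfl | hp1
  · simpa only [eLpNorm_one_eq_lintegral_enorm, enorm_eq_self] using
      (lintegral_lintegral_swap hF.aemeasurable).le
  have hr1 : 1 < p.toReal := by
    simpa using (ENNReal.toReal_lt_toReal ENNReal.one_ne_top hp').2 hp1
  simp only [eLpNorm_eq_eLpNorm' (zero_lt_one.trans hp1).ne' hp']
  set r := p.toReal
  have hr0 : 0 < r := one_pos.trans hr1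
  obtain ⟨s, hrs⟩ : ∃ s, r.HolderConjugate s := ⟨_, .conjExponent hr1⟩
  set T := ∫⁻ y, eLpNorm' (fun x => F x y) r μ ∂ν
  rw [eLpNorm', one_div, ENNReal.rpow_inv_le_iff hr0]
  -- Passing to integrable minorants `h` makes the power of `∫ h` cancellable.
  refine le_of_forall_lt fun L hL => ?_
  obtain ⟨h, hle, hfin, hLh⟩ := exists_simpleFunc_lintegral_lt_top_of_lt_lintegral hL
  have hh : Measurable fun x => (h x : ℝ≥0∞) ^ (1 / s) := by fun_prop
  have hsplit (x : X) : (h x : ℝ≥0∞) ≤ (∫⁻ y, F x y ∂ν) * (h x : ℝ≥0∞) ^ (1 / s) := by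
    have hx := hle x
    rw [enorm_eq_self, ← ENNReal.rpow_inv_le_iff hr0, ← one_div] at hx
    calc (h x : ℝ≥0∞) = (h x : ℝ≥0∞) ^ (1 / r) * (h x : ℝ≥0∞) ^ (1 / s) := by
          rw [← ENNReal.rpow_add_of_nonneg _ _ hrs.one_div_nonneg hrs.symm.one_div_nonneg,
            one_div, one_div, hrs.inv_add_inv_eq_one, ENNReal.rpow_one]
      _ ≤ _ := by gcongr
  have hbound : ∫⁻ x, h x ∂μ ≤ T * (∫⁻ x, h x ∂μ) ^ (1 / s) :=
    calc ∫⁻ x, h x ∂μ ≤ ∫⁻ x, (∫⁻ y, F x y ∂ν) * (h x : ℝ≥0∞) ^ (1 / s) ∂μ := lintegral_mono hsplit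
      _ ≤ T * eLpNorm' (fun x => (h x : ℝ≥0∞) ^ (1 / s)) s μ :=
          lintegral_lintegral_mul_le hrs hF hh
      _ = _ := by
          simp only [eLpNorm', enorm_eq_self, ← ENNReal.rpow_mul,
            one_div_mul_cancel hrs.symm.ne_zero, ENNReal.rpow_one]
  have hT := rpow_one_div_le_of_le_mul_rpow hrs hfin.ne hbound
  rw [one_div, ENNReal.rpow_inv_le_iff hr0] at hT
  exact hLh.trans_le hT

theorem lintegral_rpow_toReal_eq_eLpNorm_rpow (hp0 : p ≠ 0) (hp : p ≠ ∞) (f : X → ℝ≥0∞) :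
    ∫⁻ x, f x ^ p.toReal ∂μ = eLpNorm f p μ ^ p.toReal := by
  simp only [eLpNorm_eq_lintegral_rpow_enorm_toReal hp0 hp, enorm_eq_self, ← ENNReal.rpow_mul,
    one_div_mul_cancel (ENNReal.toReal_pos hp0 hp).ne', ENNReal.rpow_one]

theorem eLpNorm_div_rpow_toReal (hq0 : q ≠ 0) (hq : q ≠ ∞) (f : X → ℝ≥0∞) :
    eLpNorm (fun x => f x ^ q.toReal) (p / q) μ = eLpNorm f p μ ^ q.toReal := by
  have h := eLpNorm_enorm_rpow (p := p / q) (μ := μ) f (ENNReal.toReal_pos hq0 hq)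
  rwa [ENNReal.ofReal_toReal hq, ENNReal.div_mul_cancel hq0 hq] at h

theorem eLpNorm_eLpNorm_le [SigmaFinite μ] [SFinite ν] (hqp : q ≤ p) (hp : p ≠ ∞)
    {F : X → Y → ℝ≥0∞} (hF : Measurable (Function.uncurry F)) :
    eLpNorm (fun x => eLpNorm (F x) q ν) p μ ≤
      eLpNorm (fun y => eLpNorm (fun x => F x y) p μ) q ν := by
  rcases eq_or_ne q 0 with rfl | hq0
  · simp
  have hq : q ≠ ∞ := ne_top_of_le_ne_top hp hqp
  have hpq : 1 ≤ p / q := by rwa [ENNReal.le_div_iff_mul_le (.inl hq0) (.inl hq), one_mul]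
  rw [← ENNReal.rpow_le_rpow_iff (ENNReal.toReal_pos hq0 hq), ← eLpNorm_div_rpow_toReal hq0 hq,
    ← lintegral_rpow_toReal_eq_eLpNorm_rpow hq0 hq]
  simpa only [← lintegral_rpow_toReal_eq_eLpNorm_rpow hq0 hq, ← eLpNorm_div_rpow_toReal hq0 hq]
    using eLpNorm_lintegral_le hpq (by finiteness) (hF.pow_const q.toReal)

theorem eLpNorm_tsum_le {ι : Type*} [Countable ι] [SigmaFinite μ] (hp : 1 ≤ p) (hp' : p ≠ ∞)
    {f : ι → X → ℝ≥0∞} (hf : ∀ j, Measurable (f j)) :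
    eLpNorm (fun x => ∑' j, f j x) p μ ≤ ∑' j, eLpNorm (f j) p μ := by
  let : MeasurableSpace ι := ⊤
  have hF : Measurable (Function.uncurry fun x j => f j x) :=
    measurable_from_prod_countable_left hf
  simpa only [lintegral_count] using eLpNorm_lintegral_le (ν := Measure.count) hp hp' hF

theorem eLpNorm_mul_le_of_lt {p₁ : ℝ≥0∞} (hp₁ : p₁ ≠ 0) (hlt : p₁ < p) (hp : p ≠ ∞)
    {f g : X → ℝ≥0∞} (hf : AEMeasurable f μ) (hg : AEMeasurable g μ) :
    eLpNorm (fun x => f x * g x) p₁ μ ≤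
      eLpNorm f (ENNReal.ofReal (p₁.toReal⁻¹ - p.toReal⁻¹)⁻¹) μ * eLpNorm g p μ := by
  have hpos : 0 < p₁.toReal := ENNReal.toReal_pos hp₁ (ne_top_of_lt hlt)
  have hlt' : p₁.toReal < p.toReal := ENNReal.toReal_strict_mono hp hlt
  have hδ : 0 < p₁.toReal⁻¹ - p.toReal⁻¹ := sub_pos.2 (inv_strictAnti₀ hpos hlt')
  rw [eLpNorm_eq_eLpNorm' hp₁ (ne_top_of_lt hlt), eLpNorm_eq_eLpNorm' (hp₁.bot_lt.trans hlt).ne' hp,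
    eLpNorm_eq_eLpNorm' (by simpa using hδ) ENNReal.ofReal_ne_top,
    ENNReal.toReal_ofReal (inv_nonneg.2 hδ.le), mul_comm]
  simp only [mul_comm (f _)]
  refine ENNReal.lintegral_Lp_mul_le_Lq_mul_Lr hpos hlt' ?_ μ hg hf
  simp only [one_div, inv_inv, add_sub_cancel]

end LpNorm

section MixedLpNorm

variable {X V Y ε : Type*} [MeasurableSpace X] [MeasurableSpace V] [MeasurableSpace Y]
  {μ : Measure X} {ν : Measure V} {p : ℝ≥0∞ × ℝ≥0∞}

/-- The mixed Lebesgue norm on a product `X × V` of measure spaces, inner exponent `p.1` in `X`,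
outer exponent `p.2` in `V`: the norm `mixedNorm` of the phase space, in the generality in which
its Minkowski inequalities hold and for functions with values in any space with an `ENorm`. -/
def mixedLpNorm [ENorm ε] (p : ℝ≥0∞ × ℝ≥0∞) (μ : Measure X) (ν : Measure V) (F : X × V → ε) :
    ℝ≥0∞ :=
  eLpNorm (fun v => eLpNorm (fun x => F (x, v)) p.1 μ) p.2 ν

theorem mixedNorm_eq_mixedLpNorm {d : ℕ} (p : ℝ≥0∞ × ℝ≥0∞) (f : Phase d → ℂ) :
    mixedNorm p f = mixedLpNorm p volume volume fun z => f (WithLp.toLp 2 z) :=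
  rfl

theorem mixedLpNorm_enorm [TopologicalSpace ε] [ContinuousENorm ε] (F : X × V → ε) :
    mixedLpNorm p μ ν (fun z => ‖F z‖ₑ) = mixedLpNorm p μ ν F := by
  simp only [mixedLpNorm, eLpNorm_enorm (fun x => F (x, _))]

theorem mixedLpNorm_mono_enorm {ε' : Type*} [ENorm ε] [ENorm ε'] {F : X × V → ε} {G : X × V → ε'}
    (h : ∀ z, ‖F z‖ₑ ≤ ‖G z‖ₑ) : mixedLpNorm p μ ν F ≤ mixedLpNorm p μ ν G :=
  eLpNorm_mono_enorm fun _ => eLpNorm_mono_enorm fun _ => h _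

section Measurability

variable [TopologicalSpace ε] [ContinuousENorm ε] [MeasurableSpace ε] [OpensMeasurableSpace ε]
  [SFinite μ]

theorem measurable_eLpNorm_slice_left {r : ℝ≥0∞} (hr : r ≠ ∞) {F : X × V → Y → ε}
    (hF : Measurable (Function.uncurry F)) :
    Measurable (Function.uncurry fun v y => eLpNorm (fun x => F (x, v) y) r μ) :=
  measurable_eLpNorm_left hr (F := fun x (w : V × Y) => F (x, w.1) w.2)
    (hF.comp (f := fun u : X × V × Y => ((u.1, u.2.1), u.2.2)) (by fun_prop))

theorem measurable_mixedLpNorm [SFinite ν] (h₁ : p.1 ≠ ∞) (h₂ : p.2 ≠ ∞) {F : X × V → Y → ε}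
    (hF : Measurable (Function.uncurry F)) :
    Measurable fun y => mixedLpNorm p μ ν fun z => F z y :=
  measurable_eLpNorm_left h₂ (measurable_eLpNorm_slice_left h₁ hF)

theorem measurable_eLpNorm_slice {r : ℝ≥0∞} (hr : r ≠ ∞) {F : X × V → ε} (hF : Measurable F) :
    Measurable fun v => eLpNorm (fun x => F (x, v)) r μ :=
  measurable_eLpNorm_left hr (F := fun x v => F (x, v)) hF

end Measurability

theorem mixedLpNorm_add_le {E : Type*} [TopologicalSpace E] [ESeminormedAddMonoid E]
    [MeasurableSpace E] [SecondCountableTopology E] [TopologicalSpace.PseudoMetrizableSpace E]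
    [OpensMeasurableSpace E] [SFinite μ] (h₁ : 1 ≤ p.1) (h₂ : 1 ≤ p.2) (h₁' : p.1 ≠ ∞)
    {F G : X × V → E} (hF : Measurable F) (hG : Measurable G) :
    mixedLpNorm p μ ν (fun z => F z + G z) ≤ mixedLpNorm p μ ν F + mixedLpNorm p μ ν G := by
  have hslice (F : X × V → E) (hF : Measurable F) (v : V) :
      AEStronglyMeasurable (fun x => F (x, v)) μ :=
    (hF.comp measurable_prodMk_right).aestronglyMeasurable
  refine (eLpNorm_mono_enorm fun v => ?_).trans (eLpNorm_add_le
    (measurable_eLpNorm_slice h₁' hF).aestronglyMeasurable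
    (measurable_eLpNorm_slice h₁' hG).aestronglyMeasurable h₂)
  exact eLpNorm_add_le (hslice F hF v) (hslice G hG v) h₁

theorem mixedLpNorm_const_mul [SFinite μ] (h₁ : p.1 ≠ ∞) (c : ℝ≥0∞) {F : X × V → ℝ≥0∞}
    (hF : Measurable F) : mixedLpNorm p μ ν (fun z => c * F z) = c * mixedLpNorm p μ ν F := by
  have hslice (v : V) : Measurable fun x => F (x, v) := hF.comp measurable_prodMk_right
  simp only [mixedLpNorm, eLpNorm_const_mul_ennreal c (hslice _).aemeasurable]
  exact eLpNorm_const_mul_ennreal c (measurable_eLpNorm_slice h₁ hF).aemeasurable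

theorem mixedLpNorm_le_of_forall_eLpNorm_le [SFinite μ] {p₁ : ℝ≥0∞ × ℝ≥0∞} (h₁ : p.1 ≠ ∞)
    {u : X → ℝ≥0∞} {w : V → ℝ≥0∞} {A B : ℝ≥0∞} (hu : Measurable u)
    (hA : ∀ f : X → ℝ≥0∞, Measurable f → eLpNorm f p₁.1 μ ≤ A * eLpNorm (fun x => u x * f x) p.1 μ)
    (hB : ∀ f : V → ℝ≥0∞, Measurable f → eLpNorm f p₁.2 ν ≤ B * eLpNorm (fun v => w v * f v) p.2 ν)
    {F : X × V → ℝ≥0∞} (hF : Measurable F) :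
    mixedLpNorm p₁ μ ν F ≤ A * B * mixedLpNorm p μ ν fun z => u z.1 * w z.2 * F z := by
  have huF : Measurable fun z : X × V => u z.1 * F z := (hu.comp measurable_fst).mul hF
  have hG := measurable_eLpNorm_slice (μ := μ) h₁ huF
  have hw (v : V) : w v * eLpNorm (fun x => u x * F (x, v)) p.1 μ =
      eLpNorm (fun x => u x * w v * F (x, v)) p.1 μ := by
    have hslice : Measurable fun x => u x * F (x, v) := huF.comp measurable_prodMk_right
    rw [← eLpNorm_const_mul_ennreal _ hslice.aemeasurable]
    simp only [mul_assoc, mul_left_comm (w v)]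
  calc mixedLpNorm p₁ μ ν F
      ≤ eLpNorm (fun v => A * eLpNorm (fun x => u x * F (x, v)) p.1 μ) p₁.2 ν :=
        eLpNorm_mono_enorm fun v => hA _ (hF.comp measurable_prodMk_right)
    _ = A * eLpNorm (fun v => eLpNorm (fun x => u x * F (x, v)) p.1 μ) p₁.2 ν :=
        eLpNorm_const_mul_ennreal _ hG.aemeasurable
    _ ≤ A * (B * eLpNorm (fun v => w v * eLpNorm (fun x => u x * F (x, v)) p.1 μ) p.2 ν) := by
        gcongr
        exact hB _ hG
    _ = A * B * mixedLpNorm p μ ν fun z => u z.1 * w z.2 * F z := by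
        simp only [hw, mixedLpNorm, mul_assoc]

section Minkowski

variable [SigmaFinite μ] [SigmaFinite ν] {ρ : Measure Y} {r : ℝ≥0∞} {F : X × V → Y → ℝ≥0∞}

theorem mixedLpNorm_eLpNorm_le [SFinite ρ] (hr₁ : r ≤ p.1) (hr₂ : r ≤ p.2) (h₁ : p.1 ≠ ∞)
    (h₂ : p.2 ≠ ∞) (hF : Measurable (Function.uncurry F)) :
    mixedLpNorm p μ ν (fun z => eLpNorm (F z) r ρ) ≤
      eLpNorm (fun y => mixedLpNorm p μ ν fun z => F z y) r ρ := by
  have hslice (v : V) : Measurable (Function.uncurry fun x y => F (x, v) y) :=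
    hF.comp (f := fun u : X × Y => ((u.1, v), u.2)) (by fun_prop)
  exact (eLpNorm_mono_enorm fun v => eLpNorm_eLpNorm_le hr₁ h₁ (hslice v)).trans
    (eLpNorm_eLpNorm_le hr₂ h₂ (measurable_eLpNorm_slice_left h₁ hF))

theorem eLpNorm_mixedLpNorm_le [SigmaFinite ρ] (hr₁ : p.1 ≤ r) (hr₂ : p.2 ≤ r) (hr : r ≠ ∞)
    (hF : Measurable (Function.uncurry F)) :
    eLpNorm (fun y => mixedLpNorm p μ ν fun z => F z y) r ρ ≤
      mixedLpNorm p μ ν fun z => eLpNorm (F z) r ρ := by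
  have hslice (v : V) : Measurable (Function.uncurry fun y x => F (x, v) y) :=
    hF.comp (f := fun u : Y × X => ((u.2, v), u.1)) (by fun_prop)
  have hv := (measurable_eLpNorm_slice_left (μ := μ) (ne_top_of_le_ne_top hr hr₁) hF).comp
    measurable_swap
  refine (eLpNorm_eLpNorm_le (F := fun y v => eLpNorm (fun x => F (x, v) y) p.1 μ)
    hr₂ hr hv).trans (eLpNorm_mono_enorm fun v => ?_)
  exact eLpNorm_eLpNorm_le hr₁ hr (hslice v)

theorem mixedLpNorm_lintegral_le [SFinite ρ] (h₁ : 1 ≤ p.1) (h₂ : 1 ≤ p.2) (h₁' : p.1 ≠ ∞)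
    (h₂' : p.2 ≠ ∞) (hF : Measurable (Function.uncurry F)) :
    mixedLpNorm p μ ν (fun z => ∫⁻ y, F z y ∂ρ) ≤ ∫⁻ y, mixedLpNorm p μ ν (fun z => F z y) ∂ρ := by
  simpa only [eLpNorm_one_eq_lintegral_enorm, enorm_eq_self] using
    mixedLpNorm_eLpNorm_le h₁ h₂ h₁' h₂' hF

end Minkowski

end MixedLpNorm

section Khintchine

theorem eLpNorm_count_le_of_exponent_ge {X ε : Type*} [MeasurableSpace X]
    [MeasurableSingletonClass X] [TopologicalSpace ε] [ContinuousENorm ε] {p q : ℝ≥0∞}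
    (hq : q ≠ 0) (hqp : q ≤ p) (f : X → ε) :
    eLpNorm f p Measure.count ≤ eLpNorm f q Measure.count := by
  set A := eLpNorm f q Measure.count
  have hle (x : X) : ‖f x‖ₑ ≤ A := enorm_le_eLpNorm_count f x hq
  rcases eq_or_ne A ∞ with hA | hA
  · simp [hA]
  rcases eq_or_ne p ∞ with rfl | hp
  · rw [eLpNorm_exponent_top, eLpNormEssSup_eq_essSup_enorm]
    exact essSup_le_of_ae_le _ (.of_forall hle)
  have hq' : q ≠ ∞ := ne_top_of_le_ne_top hp hqp
  have hqp' : q.toReal ≤ p.toReal := ENNReal.toReal_mono hp hqp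
  have hq0 : 0 < q.toReal := ENNReal.toReal_pos hq hq'
  have hsplit (x : X) : ‖f x‖ₑ ^ p.toReal ≤ A ^ (p.toReal - q.toReal) * ‖f x‖ₑ ^ q.toReal :=
    calc ‖f x‖ₑ ^ p.toReal = ‖f x‖ₑ ^ (p.toReal - q.toReal) * ‖f x‖ₑ ^ q.toReal := by
          rw [← ENNReal.rpow_add_of_nonneg _ _ (sub_nonneg.2 hqp') hq0.le, sub_add_cancel]
      _ ≤ _ := by gcongr; exact hle x
  rw [eLpNorm_eq_lintegral_rpow_enorm_toReal ((pos_iff_ne_zero.2 hq).trans_le hqp).ne' hp, one_div,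
    ENNReal.rpow_inv_le_iff (hq0.trans_le hqp')]
  calc ∫⁻ x, ‖f x‖ₑ ^ p.toReal ∂Measure.count
      ≤ A ^ (p.toReal - q.toReal) * ∫⁻ x, ‖f x‖ₑ ^ q.toReal ∂Measure.count := by
        rw [← lintegral_const_mul' _ _ (by finiteness)]
        exact lintegral_mono hsplit
    _ = A ^ (p.toReal - q.toReal) * A ^ q.toReal := by
        rw [lintegral_rpow_toReal_eq_eLpNorm_rpow hq hq', eLpNorm_enorm]
    _ = A ^ p.toReal := by
        rw [← ENNReal.rpow_add_of_nonneg _ _ (sub_nonneg.2 hqp') hq0.le, sub_add_cancel]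

/-- The uniform law on `Bool`, i.e. that of a Rademacher variable once a Boolean `b` is read as the
sign `boolSign b`. -/
def rademacher : Measure Bool := (PMF.uniformOfFintype Bool).toMeasure

instance : IsProbabilityMeasure rademacher := by unfold rademacher; infer_instance

/-- The sign `±1` encoded by a Boolean. -/
def boolSign (b : Bool) : ℝ := if b then 1 else -1

variable {ι : Type*} [Fintype ι]

/-- The law of independent random signs indexed by `ι`. -/
def randomSigns (ι : Type*) [Fintype ι] : Measure (ι → Bool) := Measure.pi fun _ => rademacher

instance : IsProbabilityMeasure (randomSigns ι) := by unfold randomSigns; infer_instance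

/-- The signed sum `∑ ± a i` with signs encoded by `ε`. -/
def signedSum {E : Type*} [AddCommGroup E] [Module ℝ E] (a : ι → E) (ε : ι → Bool) : E :=
  ∑ i, boolSign (ε i) • a i

theorem signedSum_smul {E : Type*} [AddCommGroup E] [Module ℝ E] (c : ℝ) (a : ι → E) :
    signedSum (c • a) = c • signedSum a := by
  ext ε
  simp only [signedSum, Pi.smul_apply, Finset.smul_sum, smul_comm c]

theorem integral_rademacher (f : Bool → ℝ) : ∫ b, f b ∂rademacher = (f true + f false) / 2 := by
  rw [rademacher, PMF.integral_eq_sum, Fintype.sum_bool]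
  simp only [PMF.uniformOfFintype_apply, Fintype.card_bool, Nat.cast_ofNat, ENNReal.toReal_inv,
    ENNReal.toReal_ofNat, smul_eq_mul]
  ring

theorem integral_exp_signedSum_le (a : ι → ℝ) :
    ∫ ε, Real.exp (signedSum a ε) ∂randomSigns ι ≤ Real.exp ((∑ i, a i ^ 2) / 2) := by
  simp only [signedSum, Real.exp_sum, randomSigns, Finset.sum_div]
  rw [integral_fintype_prod_eq_prod (fun i (b : Bool) => Real.exp (boolSign b • a i))]
  refine Finset.prod_le_prod (fun i _ => by positivity) fun i _ => ?_
  rw [integral_rademacher]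
  simpa [boolSign, Real.cosh_eq] using Real.cosh_le_exp_half_sq (a i)

theorem abs_pow_le_factorial_mul_exp_add_exp_neg (M : ℕ) (x : ℝ) :
    |x| ^ M ≤ M.factorial * (Real.exp x + Real.exp (-x)) := by
  have h := (Real.pow_div_factorial_le_exp _ (abs_nonneg x) M).trans (Real.exp_abs_le x)
  rwa [div_le_iff₀' (by positivity)] at h

/-- The subgaussian constant bounding the `M`-th moment of a normalized sum of random signs. -/
def khintchineConst (M : ℕ) : ℝ := 2 * M.factorial * Real.exp (1 / 2)

theorem one_le_khintchineConst (M : ℕ) : 1 ≤ khintchineConst M := by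
  have h₁ : (1 : ℝ) ≤ M.factorial := mod_cast M.factorial_pos
  have h₂ : 1 ≤ Real.exp (1 / 2) := Real.one_le_exp (by norm_num)
  unfold khintchineConst
  nlinarith

theorem integral_abs_signedSum_pow_le (M : ℕ) {a : ι → ℝ} (ha : ∑ i, a i ^ 2 ≤ 1) :
    ∫ ε, |signedSum a ε| ^ M ∂randomSigns ι ≤ khintchineConst M := by
  have hneg (ε : ι → Bool) : -signedSum a ε = signedSum (-a) ε := by simp [signedSum]
  have hexp (b : ι → ℝ) (hb : ∑ i, b i ^ 2 ≤ 1) :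
      ∫ ε, Real.exp (signedSum b ε) ∂randomSigns ι ≤ Real.exp (1 / 2) :=
    (integral_exp_signedSum_le b).trans (by gcongr)
  calc ∫ ε, |signedSum a ε| ^ M ∂randomSigns ι
      ≤ ∫ ε, M.factorial * (Real.exp (signedSum a ε) + Real.exp (signedSum (-a) ε))
          ∂randomSigns ι :=
        integral_mono .of_finite .of_finite fun ε => by
          simpa only [hneg] using abs_pow_le_factorial_mul_exp_add_exp_neg M (signedSum a ε)
    _ = M.factorial * (∫ ε, Real.exp (signedSum a ε) ∂randomSigns ι +
          ∫ ε, Real.exp (signedSum (-a) ε) ∂randomSigns ι) := by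
        rw [integral_const_mul, integral_add .of_finite .of_finite]
    _ ≤ M.factorial * (Real.exp (1 / 2) + Real.exp (1 / 2)) := by
        gcongr
        exacts [hexp a ha, hexp (-a) (by simpa using ha)]
    _ = khintchineConst M := by rw [khintchineConst]; ring

theorem eLpNorm_signedSum_le_of_sum_sq_le_one {M : ℕ} (hM : M ≠ 0) {a : ι → ℝ}
    (ha : ∑ i, a i ^ 2 ≤ 1) :
    eLpNorm (signedSum a) M (randomSigns ι) ≤ ENNReal.ofReal (khintchineConst M) := by
  have hK := one_le_khintchineConst M
  rw [eLpNorm_eq_lintegral_rpow_enorm_toReal (by exact_mod_cast hM) (by finiteness),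
    ENNReal.toReal_natCast, one_div, ENNReal.rpow_inv_le_iff (by positivity)]
  simp only [ENNReal.rpow_natCast, ← ofReal_norm, ← ENNReal.ofReal_pow (norm_nonneg _)]
  rw [← ofReal_integral_eq_lintegral_ofReal .of_finite (.of_forall fun _ => by positivity),
    ← ENNReal.ofReal_pow (by positivity)]
  exact ENNReal.ofReal_le_ofReal
    ((integral_abs_signedSum_pow_le M ha).trans (le_self_pow₀ hK hM))

variable [MeasurableSpace ι] [MeasurableSingletonClass ι]

theorem eLpNorm_two_count {E : Type*} [NormedAddCommGroup E] (a : ι → E) :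
    eLpNorm a 2 Measure.count = ENNReal.ofReal √(∑ i, ‖a i‖ ^ 2) := by
  rw [eLpNorm_eq_lintegral_rpow_enorm_toReal two_ne_zero (by finiteness), lintegral_count,
    tsum_fintype, Real.sqrt_eq_rpow,
    ← ENNReal.ofReal_rpow_of_nonneg (by positivity) (by positivity),
    ENNReal.ofReal_sum_of_nonneg fun _ _ => by positivity]
  simp [ENNReal.ofReal_pow]

theorem eLpNorm_signedSum_le {M : ℕ} (hM : M ≠ 0) (a : ι → ℝ) :
    eLpNorm (signedSum a) M (randomSigns ι) ≤
      ENNReal.ofReal (khintchineConst M) * eLpNorm a 2 Measure.count := by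
  simp only [eLpNorm_two_count, Real.norm_eq_abs, sq_abs]
  set s := √(∑ i, a i ^ 2)
  have hs2 : s ^ 2 = ∑ i, a i ^ 2 := Real.sq_sqrt (Finset.sum_nonneg fun i _ => sq_nonneg (a i))
  have hs0 : 0 ≤ s := Real.sqrt_nonneg _
  rcases hs0.eq_or_lt with h0 | hpos
  · have ha : a = 0 := by
      rw [← h0, zero_pow two_ne_zero, eq_comm,
        Finset.sum_eq_zero_iff_of_nonneg fun i _ => sq_nonneg _] at hs2
      exact funext fun i => pow_eq_zero_iff two_ne_zero |>.1 (hs2 i (Finset.mem_univ i))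
    have hzero : signedSum a = 0 := by ext ε; simp [signedSum, ha]
    simp [hzero]
  have hunit : ∑ i, (s⁻¹ • a) i ^ 2 ≤ 1 := by
    simp only [Pi.smul_apply, smul_eq_mul, mul_pow]
    rw [← Finset.mul_sum, ← hs2, ← mul_pow, inv_mul_cancel₀ hpos.ne', one_pow]
  calc eLpNorm (signedSum a) M (randomSigns ι)
      = eLpNorm (s • signedSum (s⁻¹ • a)) M (randomSigns ι) := by
        rw [← signedSum_smul, smul_inv_smul₀ hpos.ne']
    _ = ENNReal.ofReal s * eLpNorm (signedSum (s⁻¹ • a)) M (randomSigns ι) := by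
        rw [eLpNorm_const_smul, ← ofReal_norm, Real.norm_of_nonneg hpos.le]
    _ ≤ ENNReal.ofReal s * ENNReal.ofReal (khintchineConst M) := by
        gcongr
        exact eLpNorm_signedSum_le_of_sum_sq_le_one hM hunit
    _ = _ := mul_comm _ _

theorem eLpNorm_signedSum_complex_le {M : ℕ} (hM : M ≠ 0) {q : ℝ≥0∞} (hq : q ≠ 0) (hq2 : q ≤ 2)
    (a : ι → ℂ) :
    eLpNorm (signedSum a) M (randomSigns ι) ≤
      2 * ENNReal.ofReal (khintchineConst M) * eLpNorm a q Measure.count := by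
  have hpart (b : ι → ℝ) (hb : ∀ i, ‖b i‖ ≤ ‖a i‖) : eLpNorm (signedSum b) M (randomSigns ι) ≤
      ENNReal.ofReal (khintchineConst M) * eLpNorm a q Measure.count :=
    (eLpNorm_signedSum_le hM b).trans <| mul_le_mul_right
      ((eLpNorm_mono hb).trans (eLpNorm_count_le_of_exponent_ge hq hq2 a)) _
  have hM1 : (1 : ℝ≥0∞) ≤ M := mod_cast Nat.one_le_iff_ne_zero.2 hM
  have hsplit : signedSum a = (fun ε => ((signedSum (fun i => (a i).re) ε : ℝ) : ℂ)) +
      fun ε => (signedSum (fun i => (a i).im) ε : ℝ) * Complex.I := by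
    ext ε
    apply Complex.ext <;> simp [signedSum]
  rw [hsplit]
  calc _ ≤ _ := eLpNorm_add_le .of_discrete .of_discrete hM1
    _ = eLpNorm (signedSum fun i => (a i).re) M (randomSigns ι) +
          eLpNorm (signedSum fun i => (a i).im) M (randomSigns ι) := by
        congr 1 <;> exact eLpNorm_congr_norm_ae (.of_forall fun ε => by simp)
    _ ≤ _ := add_le_add (hpart _ fun i => Complex.abs_re_le_norm _)
        (hpart _ fun i => Complex.abs_im_le_norm _)
    _ = _ := by ring

end Khintchine

section IndependentFields

variable {ι S X V E : Type*} [Fintype ι] [MeasurableSpace S] [MeasurableSpace X]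
  [MeasurableSpace V] {μ : Measure X} {ν : Measure V} {p : ℝ≥0∞ × ℝ≥0∞} {m q : ℝ≥0∞}
  {P : ι → Measure S} [∀ i, IsProbabilityMeasure (P i)]

/-- The symmetrization `(s, s') ↦ D s - D s'` of a random field `D` indexed by a sample space. -/
def symmetrization [Sub E] (D : S → X × V → E) (s : S × S) (z : X × V) : E := D s.1 z - D s.2 z

section Measurability

variable [AddCommGroup E] [MeasurableSpace E]

theorem measurable_symmetrization [MeasurableSub₂ E] {D : S → X × V → E}
    (hD : Measurable (Function.uncurry D)) : Measurable (Function.uncurry (symmetrization D)) := by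
  have h₁ : Measurable fun y : (S × S) × X × V => D y.1.1 y.2 :=
    hD.comp (f := fun y : (S × S) × X × V => (y.1.1, y.2)) (by fun_prop)
  have h₂ : Measurable fun y : (S × S) × X × V => D y.1.2 y.2 :=
    hD.comp (f := fun y : (S × S) × X × V => (y.1.2, y.2)) (by fun_prop)
  exact h₁.sub h₂

theorem measurable_sum_eval [MeasurableAdd₂ E] {D : ι → S → X × V → E}
    (hD : ∀ i, Measurable (Function.uncurry (D i))) :
    Measurable (Function.uncurry fun z (s : ι → S) => ∑ i, D i (s i) z) :=
  Finset.measurable_fun_sum _ fun i _ =>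
    (hD i).comp (f := fun y : (X × V) × (ι → S) => (y.2 i, y.1)) (by fun_prop)

end Measurability

theorem enorm_sum_sub_integral_le [NormedAddCommGroup E] [NormedSpace ℝ E] [CompleteSpace E]
    {g : ι → S → E} (hg : ∀ i, Integrable (g i) (P i)) (s : ι → S) :
    ‖∑ i, (g i (s i) - ∫ t, g i t ∂P i)‖ₑ ≤
      ∫⁻ t, ‖∑ i, (g i (s i) - g i (t i))‖ₑ ∂Measure.pi P := by
  have hmp (i : ι) := measurePreserving_eval P i
  have hint (i : ι) : Integrable (fun t : ι → S => g i (t i)) (Measure.pi P) :=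
    (hmp i).integrable_comp_of_integrable (hg i)
  have hmean (i : ι) : ∫ t, g i (s i) - g i (t i) ∂Measure.pi P = g i (s i) - ∫ t, g i t ∂P i := by
    rw [integral_sub (integrable_const _) (hint i), integral_const, probReal_univ, one_smul,
      integral_comp_eval (hg i).aestronglyMeasurable]
  have hsum : ∑ i, (g i (s i) - ∫ t, g i t ∂P i) =
      ∫ t, ∑ i, (g i (s i) - g i (t i)) ∂Measure.pi P := by
    simp only [← hmean]
    exact (integral_finsetSum _ fun i _ => (integrable_const (g i (s i))).sub (hint i)).symm
  rw [hsum]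
  exact enorm_integral_le_lintegral_enorm _

variable [SigmaFinite μ] [SigmaFinite ν] [NormedAddCommGroup E] [MeasurableSpace E] [BorelSpace E]

theorem eLpNorm_mixedLpNorm_symmetrization_le {P : Measure S} [IsProbabilityMeasure P]
    (h₁ : 1 ≤ p.1) (h₂ : 1 ≤ p.2) (h₁' : p.1 ≠ ∞) (h₂' : p.2 ≠ ∞) (hm : 1 ≤ m)
    {D : S → X × V → E} (hD : Measurable (Function.uncurry D)) :
    eLpNorm (fun s => mixedLpNorm p μ ν (symmetrization D s)) m (P.prod P) ≤
      2 * eLpNorm (fun s => mixedLpNorm p μ ν (D s)) m P := by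
  have hmixed : Measurable fun s => mixedLpNorm p μ ν (D s) :=
    measurable_mixedLpNorm h₁' h₂' (F := fun z s => D s z) (hD.comp measurable_swap)
  have hDs (s : S) : Measurable (D s) := hD.comp measurable_prodMk_left
  calc eLpNorm (fun s => mixedLpNorm p μ ν (symmetrization D s)) m (P.prod P)
      ≤ eLpNorm (fun s : S × S => mixedLpNorm p μ ν (D s.1) + mixedLpNorm p μ ν (D s.2)) m
          (P.prod P) :=
        eLpNorm_mono_enorm fun s =>
          (mixedLpNorm_mono_enorm (G := fun z => ‖D s.1 z‖ₑ + ‖D s.2 z‖ₑ)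
            fun z => enorm_sub_le).trans <| by
          simpa only [mixedLpNorm_enorm, enorm_eq_self] using
            mixedLpNorm_add_le h₁ h₂ h₁' (hDs s.1).enorm (hDs s.2).enorm
    _ ≤ eLpNorm (fun s : S × S => mixedLpNorm p μ ν (D s.1)) m (P.prod P) +
          eLpNorm (fun s : S × S => mixedLpNorm p μ ν (D s.2)) m (P.prod P) :=
        eLpNorm_add_le (hmixed.comp measurable_fst).aestronglyMeasurable
          (hmixed.comp measurable_snd).aestronglyMeasurable hm
    _ = _ := by
        rw [two_mul]
        congr 1
        · exact eLpNorm_comp_measurePreserving hmixed.aestronglyMeasurable measurePreserving_fst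
        · exact eLpNorm_comp_measurePreserving hmixed.aestronglyMeasurable measurePreserving_snd

variable [NormedSpace ℝ E] [SecondCountableTopology E]

theorem eLpNorm_mixedLpNorm_sum_sub_integral_le [CompleteSpace E] (h₁ : 1 ≤ p.1) (h₂ : 1 ≤ p.2)
    (h₁' : p.1 ≠ ∞) (h₂' : p.2 ≠ ∞) (hm : 1 ≤ m) (hm' : m ≠ ∞) {D : ι → S → X × V → E}
    (hD : ∀ i, Measurable (Function.uncurry (D i)))
    (hint : ∀ i z, Integrable (fun s => D i s z) (P i)) :
    eLpNorm (fun s => mixedLpNorm p μ ν fun z => ∑ i, (D i (s i) z - ∫ t, D i t z ∂P i)) m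
        (Measure.pi P) ≤
      eLpNorm (fun s => mixedLpNorm p μ ν fun z => ∑ i, symmetrization (D i) (s i) z) m
        (Measure.pi fun i => (P i).prod (P i)) := by
  have hDiff : Measurable (Function.uncurry fun z (y : (ι → S) × (ι → S)) =>
      ∑ i, (D i (y.1 i) z - D i (y.2 i) z)) :=
    (measurable_sum_eval fun i => measurable_symmetrization (hD i)).comp
      (f := fun u : (X × V) × (ι → S) × (ι → S) => (u.1, fun i => (u.2.1 i, u.2.2 i)))
      (by fun_prop)
  set G : (ι → S) × (ι → S) → ℝ≥0∞ := fun y =>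
    mixedLpNorm p μ ν fun z => ∑ i, (D i (y.1 i) z - D i (y.2 i) z)
  have hG : Measurable G := measurable_mixedLpNorm h₁' h₂' hDiff
  have hcond (s : ι → S) : mixedLpNorm p μ ν (fun z => ∑ i, (D i (s i) z - ∫ t, D i t z ∂P i)) ≤
      eLpNorm (fun t => G (s, t)) m (Measure.pi P) :=
    calc _ ≤ mixedLpNorm p μ ν fun z => ∫⁻ t, ‖∑ i, (D i (s i) z - D i (t i) z)‖ₑ ∂Measure.pi P :=
          mixedLpNorm_mono_enorm fun z => enorm_sum_sub_integral_le (fun i => hint i z) s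
      _ ≤ ∫⁻ t, mixedLpNorm p μ ν (fun z => ‖∑ i, (D i (s i) z - D i (t i) z)‖ₑ) ∂Measure.pi P :=
          mixedLpNorm_lintegral_le h₁ h₂ h₁' h₂' (hDiff.comp
            (f := fun u : (X × V) × (ι → S) => (u.1, s, u.2)) (by fun_prop)).enorm
      _ = eLpNorm (fun t => G (s, t)) 1 (Measure.pi P) := by
          simp only [mixedLpNorm_enorm, eLpNorm_one_eq_lintegral_enorm, enorm_eq_self, G]
      _ ≤ eLpNorm (fun t => G (s, t)) m (Measure.pi P) :=
          eLpNorm_le_eLpNorm_of_exponent_le hm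
            (hG.comp measurable_prodMk_left).aestronglyMeasurable
  calc _ ≤ eLpNorm (fun s => eLpNorm (fun t => G (s, t)) m (Measure.pi P)) m (Measure.pi P) :=
        eLpNorm_mono_enorm hcond
    _ = eLpNorm G m ((Measure.pi P).prod (Measure.pi P)) := (eLpNorm_prod hm' hG).symm
    _ = _ := (eLpNorm_comp_measurePreserving hG.aestronglyMeasurable
        (measurePreserving_arrowProdEquivProdArrow S S ι P P)).symm

theorem eLpNorm_mixedLpNorm_signedSum_symmetrization (h₁ : p.1 ≠ ∞) (h₂ : p.2 ≠ ∞)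
    {D : ι → S → X × V → E} (hD : ∀ i, Measurable (Function.uncurry (D i))) (ε : ι → Bool) :
    eLpNorm (fun s => mixedLpNorm p μ ν fun z =>
        signedSum (fun i => symmetrization (D i) (s i) z) ε) m
        (Measure.pi fun i => (P i).prod (P i)) =
      eLpNorm (fun s => mixedLpNorm p μ ν fun z => ∑ i, symmetrization (D i) (s i) z) m
        (Measure.pi fun i => (P i).prod (P i)) := by
  have hT : MeasurePreserving (fun (s : ι → S × S) i => (if ε i then id else Prod.swap) (s i))
      (Measure.pi fun i => (P i).prod (P i)) (Measure.pi fun i => (P i).prod (P i)) := by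
    refine measurePreserving_pi _ _ fun i => ?_
    cases ε i
    · exact Measure.measurePreserving_swap
    · exact MeasurePreserving.id _
  have hG : Measurable fun s : ι → S × S =>
      mixedLpNorm p μ ν fun z => ∑ i, symmetrization (D i) (s i) z :=
    measurable_mixedLpNorm h₁ h₂ (measurable_sum_eval fun i => measurable_symmetrization (hD i))
  have hswap (s : ι → S × S) (z : X × V) (i : ι) : boolSign (ε i) • symmetrization (D i) (s i) z =
      symmetrization (D i) ((if ε i then id else Prod.swap) (s i)) z := by
    cases h : ε i <;> simp [boolSign, symmetrization]
  rw [← eLpNorm_comp_measurePreserving hG.aestronglyMeasurable hT]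
  simp only [signedSum, hswap, Function.comp_def]

theorem measurable_mixedLpNorm_signedSum_eval (h₁ : p.1 ≠ ∞) (h₂ : p.2 ≠ ∞)
    {F : ι → S → X × V → ℂ} (hF : ∀ i, Measurable (Function.uncurry (F i))) :
    Measurable (Function.uncurry fun (ε : ι → Bool) (s : ι → S) =>
      mixedLpNorm p μ ν fun z => signedSum (fun i => F i (s i) z) ε) := by
  refine measurable_from_prod_countable_right fun ε => ?_
  have hsum := measurable_sum_eval (D := fun i s z => boolSign (ε i) • F i s z)
    fun i => (hF i).const_smul (boolSign (ε i))
  change Measurable fun s : ι → S => mixedLpNorm p μ ν fun z => ∑ i, boolSign (ε i) • F i (s i) z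
  exact measurable_mixedLpNorm h₁ h₂ hsum

variable [MeasurableSpace ι] [MeasurableSingletonClass ι] {M : ℕ}

theorem eLpNorm_mixedLpNorm_signedSum_le (hM : M ≠ 0) (hmM : m ≤ M) (h₁M : p.1 ≤ M)
    (h₂M : p.2 ≤ M) (hq : q ≠ 0) (hq2 : q ≤ 2) (hq₁ : q ≤ p.1) (hq₂ : q ≤ p.2)
    {a : ι → X × V → ℂ} (ha : ∀ i, Measurable (a i)) :
    eLpNorm (fun ε => mixedLpNorm p μ ν fun z => signedSum (fun i => a i z) ε) m (randomSigns ι) ≤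
      2 * ENNReal.ofReal (khintchineConst M) *
        eLpNorm (fun i => mixedLpNorm p μ ν (a i)) q Measure.count := by
  have hM' : (M : ℝ≥0∞) ≠ ∞ := by finiteness
  have h₁ : p.1 ≠ ∞ := ne_top_of_le_ne_top hM' h₁M
  have h₂ : p.2 ≠ ∞ := ne_top_of_le_ne_top hM' h₂M
  have hsigned : Measurable (Function.uncurry fun z (ε : ι → Bool) =>
      ‖signedSum (fun i => a i z) ε‖ₑ) := by
    refine measurable_from_prod_countable_left fun ε => Measurable.enorm ?_
    exact Finset.measurable_fun_sum _ fun i _ => (ha i).const_smul (boolSign (ε i))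
  have hfam : Measurable (Function.uncurry fun z i => ‖a i z‖ₑ) :=
    measurable_from_prod_countable_left fun i => (ha i).enorm
  simp only [← mixedLpNorm_enorm (ε := ℂ)]
  calc _ ≤ eLpNorm (fun ε => mixedLpNorm p μ ν fun z => ‖signedSum (fun i => a i z) ε‖ₑ) M
          (randomSigns ι) :=
        eLpNorm_le_eLpNorm_of_exponent_le hmM .of_discrete
    _ ≤ mixedLpNorm p μ ν fun z => eLpNorm (fun ε => ‖signedSum (fun i => a i z) ε‖ₑ) M
          (randomSigns ι) := eLpNorm_mixedLpNorm_le h₁M h₂M hM' hsigned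
    _ ≤ mixedLpNorm p μ ν fun z => 2 * ENNReal.ofReal (khintchineConst M) *
          eLpNorm (fun i => ‖a i z‖ₑ) q Measure.count :=
        mixedLpNorm_mono_enorm fun z => by
          simpa only [eLpNorm_enorm, enorm_eq_self] using
            eLpNorm_signedSum_complex_le hM hq hq2 fun i => a i z
    _ = 2 * ENNReal.ofReal (khintchineConst M) *
          mixedLpNorm p μ ν fun z => eLpNorm (fun i => ‖a i z‖ₑ) q Measure.count :=
        mixedLpNorm_const_mul h₁ _
          (measurable_eLpNorm_right (ne_top_of_le_ne_top h₁ hq₁) hfam)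
    _ ≤ _ := by gcongr; exact mixedLpNorm_eLpNorm_le hq₁ hq₂ h₁ h₂ hfam

theorem measurable_mixedLpNorm_eval {κ : Type*} [Countable κ] [MeasurableSpace κ]
    [MeasurableSingletonClass κ] (h₁ : p.1 ≠ ∞) (h₂ : p.2 ≠ ∞) {F : κ → S → X × V → ℂ}
    (hF : ∀ i, Measurable (Function.uncurry (F i))) :
    Measurable (Function.uncurry fun (s : κ → S) i => mixedLpNorm p μ ν (F i (s i))) :=
  measurable_from_prod_countable_left fun i =>
    (measurable_mixedLpNorm h₁ h₂ (F := fun z s => F i s z) ((hF i).comp measurable_swap)).comp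
      (measurable_pi_apply i)

theorem eLpNorm_mixedLpNorm_sum_symmetrization_le (hM : M ≠ 0) (hmM : m ≤ M) (h₁M : p.1 ≤ M)
    (h₂M : p.2 ≤ M) (hq : q ≠ 0) (hq2 : q ≤ 2) (hq₁ : q ≤ p.1) (hq₂ : q ≤ p.2) (hqm : q ≤ m)
    {D : ι → S → X × V → ℂ} (hD : ∀ i, Measurable (Function.uncurry (D i))) :
    eLpNorm (fun s => mixedLpNorm p μ ν fun z => ∑ i, symmetrization (D i) (s i) z) m
        (Measure.pi fun i => (P i).prod (P i)) ≤
      2 * ENNReal.ofReal (khintchineConst M) * eLpNorm (fun i => eLpNorm (fun s =>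
        mixedLpNorm p μ ν (symmetrization (D i) s)) m ((P i).prod (P i))) q Measure.count := by
  have hM' : (M : ℝ≥0∞) ≠ ∞ := by finiteness
  have h₁ : p.1 ≠ ∞ := ne_top_of_le_ne_top hM' h₁M
  have h₂ : p.2 ≠ ∞ := ne_top_of_le_ne_top hM' h₂M
  have hm : m ≠ ∞ := ne_top_of_le_ne_top hM' hmM
  have hm0 : m ≠ 0 := ((pos_iff_ne_zero.2 hq).trans_le hqm).ne'
  set Q := Measure.pi fun i => (P i).prod (P i)
  set K := 2 * ENNReal.ofReal (khintchineConst M)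
  have hsym (i : ι) := measurable_symmetrization (hD i)
  have heval := measurable_mixedLpNorm_eval (μ := μ) (ν := ν) h₁ h₂ hsym
  have hcoord (i : ι) : eLpNorm (fun s : ι → S × S =>
      mixedLpNorm p μ ν (symmetrization (D i) (s i))) m Q =
      eLpNorm (fun s => mixedLpNorm p μ ν (symmetrization (D i) s)) m ((P i).prod (P i)) :=
    eLpNorm_comp_measurePreserving (g := fun s => mixedLpNorm p μ ν (symmetrization (D i) s))
      (measurable_mixedLpNorm h₁ h₂ (F := fun z s => symmetrization (D i) s z)
        ((hsym i).comp measurable_swap)).aestronglyMeasurable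
      (measurePreserving_eval (fun i => (P i).prod (P i)) i)
  calc _ = eLpNorm (fun ε => eLpNorm (fun s => mixedLpNorm p μ ν fun z =>
          signedSum (fun i => symmetrization (D i) (s i) z) ε) m Q) m (randomSigns ι) := by
        simp only [Q, eLpNorm_mixedLpNorm_signedSum_symmetrization h₁ h₂ hD]
        simp [eLpNorm_const _ hm0 (IsProbabilityMeasure.ne_zero (randomSigns ι))]
    _ ≤ eLpNorm (fun s => eLpNorm (fun ε => mixedLpNorm p μ ν fun z =>
          signedSum (fun i => symmetrization (D i) (s i) z) ε) m (randomSigns ι)) m Q :=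
        eLpNorm_eLpNorm_le le_rfl hm (measurable_mixedLpNorm_signedSum_eval h₁ h₂ hsym)
    _ ≤ eLpNorm (fun s => K * eLpNorm (fun i =>
          mixedLpNorm p μ ν (symmetrization (D i) (s i))) q Measure.count) m Q :=
        eLpNorm_mono_enorm fun s => eLpNorm_mixedLpNorm_signedSum_le hM hmM h₁M h₂M hq hq2 hq₁ hq₂
          fun i => (hsym i).comp measurable_prodMk_left
    _ = K * eLpNorm (fun s => eLpNorm (fun i =>
          mixedLpNorm p μ ν (symmetrization (D i) (s i))) q Measure.count) m Q :=
        eLpNorm_const_mul_ennreal K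
          (measurable_eLpNorm_right (ne_top_of_le_ne_top hm hqm) heval).aemeasurable
    _ ≤ K * eLpNorm (fun i => eLpNorm (fun s =>
          mixedLpNorm p μ ν (symmetrization (D i) (s i))) m Q) q Measure.count := by
        gcongr
        exact eLpNorm_eLpNorm_le hqm hm heval
    _ = _ := by simp only [hcoord]

theorem eLpNorm_mixedLpNorm_sum_sub_integral_le_count (hM : M ≠ 0) (hmM : m ≤ M) (h₁M : p.1 ≤ M)
    (h₂M : p.2 ≤ M) (h₁ : 1 ≤ p.1) (h₂ : 1 ≤ p.2) (hm : 1 ≤ m)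
    (hq : q ≠ 0) (hq2 : q ≤ 2) (hq₁ : q ≤ p.1) (hq₂ : q ≤ p.2) (hqm : q ≤ m)
    {D : ι → S → X × V → ℂ} (hD : ∀ i, Measurable (Function.uncurry (D i)))
    (hint : ∀ i z, Integrable (fun s => D i s z) (P i)) :
    eLpNorm (fun s => mixedLpNorm p μ ν fun z => ∑ i, (D i (s i) z - ∫ t, D i t z ∂P i)) m
        (Measure.pi P) ≤
      4 * ENNReal.ofReal (khintchineConst M) *
        eLpNorm (fun i => eLpNorm (fun s => mixedLpNorm p μ ν (D i s)) m (P i)) q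
          Measure.count := by
  have hM' : (M : ℝ≥0∞) ≠ ∞ := by finiteness
  have h₁' : p.1 ≠ ∞ := ne_top_of_le_ne_top hM' h₁M
  have h₂' : p.2 ≠ ∞ := ne_top_of_le_ne_top hM' h₂M
  calc _ ≤ _ := eLpNorm_mixedLpNorm_sum_sub_integral_le h₁ h₂ h₁' h₂' hm
        (ne_top_of_le_ne_top hM' hmM) hD hint
    _ ≤ _ := eLpNorm_mixedLpNorm_sum_symmetrization_le hM hmM h₁M h₂M hq hq2 hq₁ hq₂ hqm hD
    _ ≤ 2 * ENNReal.ofReal (khintchineConst M) * eLpNorm (fun i =>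
          2 * eLpNorm (fun s => mixedLpNorm p μ ν (D i s)) m (P i)) q Measure.count := by
        gcongr
        exact eLpNorm_mono_enorm fun i =>
          eLpNorm_mixedLpNorm_symmetrization_le h₁ h₂ h₁' h₂' hm (hD i)
    _ = _ := by
        rw [eLpNorm_const_mul_ennreal 2 (measurable_of_finite _).aemeasurable]
        ring

end IndependentFields

section ChangeOfVariables

variable {X X' V V' ε : Type*} [MeasurableSpace X] [MeasurableSpace X'] [MeasurableSpace V]
  [MeasurableSpace V'] {μ : Measure X} {ν : Measure V} {p : ℝ≥0∞ × ℝ≥0∞}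

theorem mixedLpNorm_map [TopologicalSpace ε] [ContinuousENorm ε] {S : X → X'} {T : V → V'}
    (hS : MeasurableEmbedding S) (hT : MeasurableEmbedding T) (F : X' × V' → ε) :
    mixedLpNorm p (μ.map S) (ν.map T) F = mixedLpNorm p μ ν fun z => F (S z.1, T z.2) := by
  simp only [mixedLpNorm, hS.eLpNorm_map_measure, hT.eLpNorm_map_measure]
  rfl

theorem mixedLpNorm_smul_measure [SFinite μ] (h₁ : p.1 ≠ ∞) (h₂ : p.2 ≠ ∞) (c e : ℝ≥0∞)
    {F : X × V → ℝ≥0∞} (hF : Measurable F) :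
    mixedLpNorm p (c • μ) (e • ν) F =
      c ^ (p.1⁻¹).toReal * e ^ (p.2⁻¹).toReal * mixedLpNorm p μ ν F := by
  simp only [mixedLpNorm, eLpNorm_smul_measure_of_ne_top h₁, eLpNorm_smul_measure_of_ne_top h₂,
    smul_eq_mul, one_div]
  rw [eLpNorm_const_mul_ennreal _ (measurable_eLpNorm_slice h₁ hF).aemeasurable]
  ring

theorem mixedLpNorm_one {F : X × V → ℝ≥0∞} [SFinite μ] [SFinite ν] (hF : Measurable F) :
    mixedLpNorm (1, 1) μ ν F = ∫⁻ z, F z ∂μ.prod ν := by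
  simp only [mixedLpNorm, eLpNorm_one_eq_lintegral_enorm, enorm_eq_self]
  rw [lintegral_prod_symm' _ hF]

theorem mixedLpNorm_mul [SFinite μ] (c : ℝ≥0∞) {f : X → ℝ≥0∞} {g : V → ℝ≥0∞}
    (hf : Measurable f) (hg : Measurable g) :
    mixedLpNorm p μ ν (fun z => c * (f z.1 * g z.2)) = c * (eLpNorm f p.1 μ * eLpNorm g p.2 ν) := by
  have h (v : V) : eLpNorm (fun x => c * (f x * g v)) p.1 μ = c * eLpNorm f p.1 μ * g v := by
    rw [eLpNorm_const_mul_ennreal _ (hf.mul_const _).aemeasurable]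
    simp only [mul_comm _ (g v)]
    rw [eLpNorm_const_mul_ennreal _ hf.aemeasurable]
    ring
  simp only [mixedLpNorm, h]
  rw [eLpNorm_const_mul_ennreal _ hg.aemeasurable, mul_assoc]

theorem mixedLpNorm_comp_sub [AddGroup X] [MeasurableAdd X] [AddGroup V] [MeasurableAdd V]
    [μ.IsAddRightInvariant] [ν.IsAddRightInvariant] [TopologicalSpace ε] [ContinuousENorm ε]
    (F : X × V → ε) (u : X × V) :
    mixedLpNorm p μ ν (fun z => F (z - u)) = mixedLpNorm p μ ν F := by
  have h := mixedLpNorm_map (p := p) (μ := μ) (ν := ν) (measurableEmbedding_addRight (-u.1))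
    (measurableEmbedding_addRight (-u.2)) F
  rw [map_add_right_eq_self, map_add_right_eq_self] at h
  simp only [sub_eq_add_neg]
  exact h.symm

theorem mixedLpNorm_comp_smul [NormedAddCommGroup X] [NormedSpace ℝ X] [FiniteDimensional ℝ X]
    [BorelSpace X] [μ.IsAddHaarMeasure] [NormedAddCommGroup V] [NormedSpace ℝ V]
    [FiniteDimensional ℝ V] [BorelSpace V] [ν.IsAddHaarMeasure] (h₁ : p.1 ≠ ∞) (h₂ : p.2 ≠ ∞)
    {s t : ℝ} (hs : 0 < s) (ht : 0 < t) {F : X × V → ℝ≥0∞} (hF : Measurable F) :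
    mixedLpNorm p μ ν (fun z => F (s • z.1, t • z.2)) =
      ENNReal.ofReal (s ^ (-(Module.finrank ℝ X * (p.1⁻¹).toReal)) *
        t ^ (-(Module.finrank ℝ V * (p.2⁻¹).toReal))) * mixedLpNorm p μ ν F := by
  have hpow (n : ℕ) (e : ℝ) {r : ℝ} (hr : 0 < r) :
      ENNReal.ofReal |(r ^ n)⁻¹| ^ e = ENNReal.ofReal (r ^ (-(n * e))) := by
    rw [abs_of_pos (by positivity), ENNReal.ofReal_rpow_of_pos (by positivity),
      Real.inv_rpow (by positivity), ← Real.rpow_natCast_mul hr.le, Real.rpow_neg hr.le]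
  have hmap := mixedLpNorm_map (p := p) (μ := μ) (ν := ν)
    (Homeomorph.smulOfNeZero s hs.ne').measurableEmbedding
    (Homeomorph.smulOfNeZero t ht.ne').measurableEmbedding F
  refine hmap.symm.trans ?_
  change mixedLpNorm p (μ.map (s • ·)) (ν.map (t • ·)) F = _
  rw [Measure.map_addHaar_smul μ hs.ne', Measure.map_addHaar_smul ν ht.ne',
    mixedLpNorm_smul_measure h₁ h₂ _ _ hF, hpow _ _ hs, hpow _ _ ht,
    ← ENNReal.ofReal_mul (by positivity)]

end ChangeOfVariables

section PolyWeight

variable {E : Type*} [NormedAddCommGroup E] {r k : ℝ}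

/-- The polynomial weight `(1 + ‖x‖^{1/r})^k` used to trade integrability for moments. -/
def polyWeight (r k : ℝ) (x : E) : ℝ := (1 + ‖x‖ ^ (1 / r)) ^ k

theorem continuous_polyWeight (hr : 0 ≤ r) : Continuous (polyWeight r k : E → ℝ) :=
  (continuous_const.add (continuous_norm.rpow_const fun _ => .inr (by positivity))).rpow_const
    fun x => .inl (by positivity : 0 < 1 + ‖x‖ ^ (1 / r)).ne'

theorem polyWeight_nonneg (r k : ℝ) (x : E) : 0 ≤ polyWeight r k x := by
  unfold polyWeight
  positivity

theorem one_le_polyWeight (r : ℝ) (hk : 0 ≤ k) (x : E) : 1 ≤ polyWeight r k x :=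
  Real.one_le_rpow (le_add_of_nonneg_right (by positivity)) hk

theorem polyWeight_add_le (hr : 1 ≤ r) (hk : 0 ≤ k) (x y : E) :
    polyWeight r k (x + y) ≤ polyWeight r k x * polyWeight r k y := by
  unfold polyWeight
  rw [← Real.mul_rpow (by positivity) (by positivity)]
  refine Real.rpow_le_rpow (by positivity) ?_ hk
  have h : ‖x + y‖ ^ (1 / r) ≤ ‖x‖ ^ (1 / r) + ‖y‖ ^ (1 / r) :=
    (Real.rpow_le_rpow (norm_nonneg _) (norm_add_le x y) (by positivity)).trans
      (Real.rpow_add_le_add_rpow (norm_nonneg _) (norm_nonneg _) (by positivity)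
        (div_le_one_of_le₀ hr (by positivity)))
  nlinarith [mul_nonneg (Real.rpow_nonneg (norm_nonneg x) (1 / r))
    (Real.rpow_nonneg (norm_nonneg y) (1 / r))]

theorem polyWeight_le_smul [NormedSpace ℝ E] (hr : 0 ≤ r) (hk : 0 ≤ k) {s : ℝ} (hs : 1 ≤ s)
    (x : E) : polyWeight r k x ≤ polyWeight r k (s • x) := by
  unfold polyWeight
  gcongr
  rw [norm_smul]
  exact le_mul_of_one_le_left (norm_nonneg _) (hs.trans (Real.le_norm_self s))

theorem polyWeight_le_two_mul_rpow (hr : 1 ≤ r) (hk : 0 ≤ k) (x : E) :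
    polyWeight r k x ≤ (2 * (1 + ‖x‖)) ^ k := by
  refine Real.rpow_le_rpow (by positivity) ?_ hk
  have h : ‖x‖ ^ (1 / r) ≤ (1 + ‖x‖) ^ (1 : ℝ) :=
    (Real.rpow_le_rpow (norm_nonneg x) (by linarith) (by positivity)).trans
      (Real.rpow_le_rpow_of_exponent_le (by linarith [norm_nonneg x])
        (div_le_one_of_le₀ hr (by positivity)))
  rw [Real.rpow_one] at h
  linarith [norm_nonneg x]

theorem inv_polyWeight_le (hr : 1 ≤ r) (hk : 0 ≤ k) (x : E) :
    (polyWeight r k x)⁻¹ ≤ (1 + ‖x‖) ^ (-(k / r)) := by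
  rw [Real.rpow_neg (by positivity), div_eq_inv_mul, Real.rpow_mul (by positivity), ← one_div r]
  refine inv_anti₀ (by positivity) (Real.rpow_le_rpow (by positivity) ?_ hk)
  simpa using Real.rpow_add_le_add_rpow zero_le_one (norm_nonneg x) (p := 1 / r) (by positivity)
    (div_le_one_of_le₀ hr (by positivity))

variable [NormedSpace ℝ E] [FiniteDimensional ℝ E] [MeasurableSpace E] [BorelSpace E]
  {μ : Measure E} [μ.IsAddHaarMeasure]

theorem eLpNorm_one_add_norm_rpow_lt_top {p : ℝ≥0∞} (hp₀ : p ≠ 0) (hp : p ≠ ∞) {s : ℝ}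
    (hs : Module.finrank ℝ E < s * p.toReal) :
    eLpNorm (fun x : E => (1 + ‖x‖) ^ (-s)) p μ < ∞ := by
  have hpow (x : E) : ‖(1 + ‖x‖) ^ (-s)‖ₑ ^ p.toReal =
      ENNReal.ofReal ((1 + ‖x‖) ^ (-(s * p.toReal))) := by
    rw [Real.enorm_of_nonneg (by positivity), ENNReal.ofReal_rpow_of_nonneg (by positivity)
      ENNReal.toReal_nonneg, ← Real.rpow_mul (by positivity), neg_mul]
  rw [eLpNorm_lt_top_iff_lintegral_rpow_enorm_lt_top hp₀ hp]
  simpa only [hpow] using finite_integral_one_add_norm hs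

/-- Hölder's inequality against the inverse weight, which lies in `L^s` for
`1/s = 1/p₁ - 1/p`. -/
theorem exists_eLpNorm_le_eLpNorm_polyWeight_mul {p₁ p : ℝ≥0∞} (hr : 1 ≤ r) (hk : 0 ≤ k)
    (hp₁ : p₁ ≠ 0) (hle : p₁ ≤ p) (hp : p ≠ ∞)
    (h : p₁ = p ∨ r * Module.finrank ℝ E * ((p₁⁻¹).toReal - (p⁻¹).toReal) < k) :
    ∃ C : ℝ≥0∞, C ≠ ∞ ∧ ∀ f : E → ℝ≥0∞, Measurable f →
      eLpNorm f p₁ μ ≤ C * eLpNorm (fun x => ‖polyWeight r k x‖ₑ * f x) p μ := by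
  have hw (x : E) : 1 ≤ ‖polyWeight r k x‖ₑ := by
    simpa [Real.enorm_of_nonneg (polyWeight_nonneg r k x)] using one_le_polyWeight r hk x
  rcases hle.eq_or_lt with rfl | hlt
  · exact ⟨1, ENNReal.one_ne_top, fun f _ => by
      simpa only [one_mul] using eLpNorm_mono_enorm fun x => le_mul_of_one_le_left' (hw x)⟩
  have hp₁' : p₁ ≠ ∞ := ne_top_of_lt hlt
  have hpos : 0 < p₁.toReal := ENNReal.toReal_pos hp₁ hp₁'
  have hlt' : p₁.toReal < p.toReal := ENNReal.toReal_strict_mono hp hlt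
  have hgap := h.resolve_left hlt.ne
  rw [ENNReal.toReal_inv, ENNReal.toReal_inv] at hgap
  set δ := p₁.toReal⁻¹ - p.toReal⁻¹
  have hδ : 0 < δ := sub_pos.2 (inv_strictAnti₀ hpos hlt')
  have hfin : eLpNorm (fun x : E => (1 + ‖x‖) ^ (-(k / r))) (ENNReal.ofReal δ⁻¹) μ < ∞ := by
    refine eLpNorm_one_add_norm_rpow_lt_top (by simpa using hδ) (by simp) ?_
    rw [ENNReal.toReal_ofReal (by positivity), ← div_eq_mul_inv, lt_div_iff₀ hδ,
      lt_div_iff₀ (by linarith)]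
    linarith
  refine ⟨_, hfin.ne, fun f hf => ?_⟩
  have hw_meas : Measurable fun x : E => ‖polyWeight r k x‖ₑ :=
    (continuous_polyWeight (by linarith)).measurable.enorm
  have hinv (x : E) : ‖polyWeight r k x‖ₑ⁻¹ ≤ ‖(1 + ‖x‖) ^ (-(k / r))‖ₑ := by
    rw [← enorm_inv (zero_lt_one.trans_le (one_le_polyWeight r hk x)).ne',
      Real.enorm_of_nonneg (inv_nonneg.2 (polyWeight_nonneg r k x)),
      Real.enorm_of_nonneg (by positivity)]
    exact ENNReal.ofReal_le_ofReal (inv_polyWeight_le hr hk x)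
  calc eLpNorm f p₁ μ
      = eLpNorm (fun x => ‖polyWeight r k x‖ₑ⁻¹ * (‖polyWeight r k x‖ₑ * f x)) p₁ μ := by
        simp only [ENNReal.inv_mul_cancel_left (zero_lt_one.trans_le (hw _)).ne' enorm_ne_top]
    _ ≤ eLpNorm (fun x : E => ‖polyWeight r k x‖ₑ⁻¹) (ENNReal.ofReal δ⁻¹) μ *
          eLpNorm (fun x => ‖polyWeight r k x‖ₑ * f x) p μ :=
        eLpNorm_mul_le_of_lt hp₁ hlt hp hw_meas.inv.aemeasurable (hw_meas.mul hf).aemeasurable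
    _ ≤ _ := by
        gcongr
        exact eLpNorm_mono_enorm hinv

end PolyWeight

section PhaseWeight

variable {d : ℕ} {α k l : ℝ} {p p₁ : ℝ≥0∞ × ℝ≥0∞}

/-- The weight `(1 + |x|^{1/(1+α)})^k (1 + |v|)^l` on the phase space: its factors grow at the
anisotropic rates of `anorm`, so that moments of `anorm` control its moments. -/
def phaseWeight (α k l : ℝ) (z : Phase d) : ℝ :=
  polyWeight (1 + α) k z.fst * polyWeight 1 l z.snd

/-- The mixed norm `‖w f‖_p` of a function on the phase space against `w = phaseWeight α k l`.
It is written through `ENorm`, so that real, complex and `ℝ≥0∞`-valued `f` are all covered. -/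
def weightedNorm {ε : Type*} [ENorm ε] (α k l : ℝ) (p : ℝ≥0∞ × ℝ≥0∞) (f : Phase d → ε) : ℝ≥0∞ :=
  mixedLpNorm p volume volume fun z =>
    ‖phaseWeight α k l (WithLp.toLp 2 z)‖ₑ * ‖f (WithLp.toLp 2 z)‖ₑ

theorem continuous_phaseWeight (hα : 0 ≤ α) :
    Continuous (phaseWeight α k l : Phase d → ℝ) :=
  ((continuous_polyWeight (by linarith)).comp (WithLp.continuous_fst _ _ _)).mul
    ((continuous_polyWeight zero_le_one).comp (WithLp.continuous_snd _ _ _))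

theorem phaseWeight_nonneg (α k l : ℝ) (z : Phase d) : 0 ≤ phaseWeight α k l z :=
  mul_nonneg (polyWeight_nonneg _ _ _) (polyWeight_nonneg _ _ _)

theorem enorm_phaseWeight_mono {z w : Phase d} {c : ℝ}
    (h : phaseWeight α k l z ≤ c * phaseWeight α k l w) (hc : 0 ≤ c) :
    ‖phaseWeight α k l z‖ₑ ≤ ‖c‖ₑ * ‖phaseWeight α k l w‖ₑ := by
  rw [← enorm_mul, Real.enorm_of_nonneg (phaseWeight_nonneg _ _ _ _),
    Real.enorm_of_nonneg (mul_nonneg hc (phaseWeight_nonneg _ _ _ _))]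
  exact ENNReal.ofReal_le_ofReal h

theorem enorm_phaseWeight_add_le (hα : 0 ≤ α) (hk : 0 ≤ k) (hl : 0 ≤ l) (z w : Phase d) :
    ‖phaseWeight α k l (z + w)‖ₑ ≤ ‖phaseWeight α k l z‖ₑ * ‖phaseWeight α k l w‖ₑ := by
  refine enorm_phaseWeight_mono ?_ (phaseWeight_nonneg _ _ _ _)
  unfold phaseWeight
  rw [mul_mul_mul_comm]
  exact mul_le_mul (polyWeight_add_le (by linarith) hk _ _) (polyWeight_add_le le_rfl hl _ _)
    (polyWeight_nonneg _ _ _) (mul_nonneg (polyWeight_nonneg _ _ _) (polyWeight_nonneg _ _ _))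

theorem enorm_phaseWeight_le_scale (hα : 0 ≤ α) (hk : 0 ≤ k) (hl : 0 ≤ l) {s t : ℝ} (hs : 1 ≤ s)
    (ht : 1 ≤ t) (z : Phase d) :
    ‖phaseWeight α k l z‖ₑ ≤
      ‖phaseWeight α k l (WithLp.toLp 2 (s • z.fst, t • z.snd) : Phase d)‖ₑ := by
  rw [Real.enorm_of_nonneg (phaseWeight_nonneg _ _ _ _),
    Real.enorm_of_nonneg (phaseWeight_nonneg _ _ _ _)]
  exact ENNReal.ofReal_le_ofReal (mul_le_mul (polyWeight_le_smul (by linarith) hk hs _)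
    (polyWeight_le_smul zero_le_one hl ht _) (polyWeight_nonneg _ _ _) (polyWeight_nonneg _ _ _))

variable {ε : Type*} [TopologicalSpace ε] [ContinuousENorm ε] [MeasurableSpace ε]
  [OpensMeasurableSpace ε]

theorem measurable_enorm_phaseWeight_mul (hα : 0 ≤ α) {f : Phase d → ε} (hf : Measurable f) :
    Measurable fun z => ‖phaseWeight α k l z‖ₑ * ‖f z‖ₑ :=
  (continuous_phaseWeight hα).measurable.enorm.mul hf.enorm

theorem weightedNorm_one (hα : 0 ≤ α) {f : Phase d → ε} (hf : Measurable f) :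
    weightedNorm α k l (1, 1) f = ∫⁻ z, ‖phaseWeight α k l z‖ₑ * ‖f z‖ₑ := by
  have hm := measurable_enorm_phaseWeight_mul (k := k) (l := l) hα hf
  have hvol := WithLp.volume_preserving_toLp (EuclideanSpace ℝ (Fin d)) (EuclideanSpace ℝ (Fin d))
  rw [← hvol.lintegral_comp hm, Measure.volume_eq_prod]
  exact mixedLpNorm_one (hm.comp hvol.measurable)

theorem weightedNorm_comp_sub_le (hα : 0 ≤ α) (hk : 0 ≤ k) (hl : 0 ≤ l)
    (h₁ : p.1 ≠ ∞) {f : Phase d → ε} (hf : Measurable f) (u : Phase d) :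
    weightedNorm α k l p (fun z => f (z - u)) ≤
      ‖phaseWeight α k l u‖ₑ * weightedNorm α k l p f := by
  set G : EuclideanSpace ℝ (Fin d) × EuclideanSpace ℝ (Fin d) → ℝ≥0∞ :=
    fun z => ‖phaseWeight α k l (WithLp.toLp 2 z)‖ₑ * ‖f (WithLp.toLp 2 z)‖ₑ
  have hG : Measurable G :=
    (measurable_enorm_phaseWeight_mul hα hf).comp (WithLp.measurable_toLp _ _)
  calc weightedNorm α k l p (fun z => f (z - u))
      ≤ mixedLpNorm p volume volume fun z => ‖phaseWeight α k l u‖ₑ * G (z - WithLp.ofLp u) := by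
        refine mixedLpNorm_mono_enorm fun z => ?_
        have hw := enorm_phaseWeight_add_le hα hk hl u (WithLp.toLp 2 z - u)
        rw [add_sub_cancel] at hw
        simpa only [enorm_eq_self, G, mul_assoc, WithLp.toLp_sub] using
          mul_le_mul_left hw ‖f (WithLp.toLp 2 z - u)‖ₑ
    _ = ‖phaseWeight α k l u‖ₑ * mixedLpNorm p volume volume G := by
        have hshift : Measurable fun z => G (z - WithLp.ofLp u) :=
          hG.comp (measurable_id.sub_const _)
        rw [mixedLpNorm_const_mul h₁ _ hshift, mixedLpNorm_comp_sub]

theorem exists_mixedNorm_le_weightedNorm (hα : 0 ≤ α) (hk : 0 ≤ k) (hl : 0 ≤ l) (h₁ : p₁.1 ≠ 0)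
    (h₂ : p₁.2 ≠ 0) (hle₁ : p₁.1 ≤ p.1) (hle₂ : p₁.2 ≤ p.2) (hp₁ : p.1 ≠ ∞) (hp₂ : p.2 ≠ ∞)
    (hx : p₁.1 = p.1 ∨ (1 + α) * d * ((p₁.1⁻¹).toReal - (p.1⁻¹).toReal) < k)
    (hv : p₁.2 = p.2 ∨ d * ((p₁.2⁻¹).toReal - (p.2⁻¹).toReal) < l) :
    ∃ C : ℝ≥0∞, C ≠ ∞ ∧ ∀ f : Phase d → ℂ, Measurable f →
      mixedNorm p₁ f ≤ C * weightedNorm α k l p f := by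
  obtain ⟨A, hA, hfA⟩ := exists_eLpNorm_le_eLpNorm_polyWeight_mul (r := 1 + α)
    (μ := (volume : Measure (EuclideanSpace ℝ (Fin d)))) (by linarith) hk h₁ hle₁ hp₁
    (by simpa only [finrank_euclideanSpace_fin] using hx)
  obtain ⟨B, hB, hfB⟩ := exists_eLpNorm_le_eLpNorm_polyWeight_mul (r := 1)
    (μ := (volume : Measure (EuclideanSpace ℝ (Fin d)))) le_rfl hl h₂ hle₂ hp₂
    (by simpa only [finrank_euclideanSpace_fin, one_mul] using hv)
  refine ⟨A * B, ENNReal.mul_ne_top hA hB, fun f hf => ?_⟩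
  have hu : Measurable fun x : EuclideanSpace ℝ (Fin d) => ‖polyWeight (1 + α) k x‖ₑ :=
    (continuous_polyWeight (by linarith)).measurable.enorm
  rw [mixedNorm_eq_mixedLpNorm, ← mixedLpNorm_enorm]
  simp only [weightedNorm, phaseWeight, enorm_mul]
  exact mixedLpNorm_le_of_forall_eLpNorm_le hp₁ hu hfA hfB
    (hf.comp (WithLp.measurable_toLp _ _)).enorm

end PhaseWeight

section SchwartzWeight

variable {d : ℕ} {α k l : ℝ} {p : ℝ≥0∞ × ℝ≥0∞}

theorem exists_norm_schwartz_le {E : Type*} [NormedAddCommGroup E] [NormedSpace ℝ E]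
    (f : 𝓢(Phase d, E)) (a b : ℝ) :
    ∃ C : ℝ, ∀ z, ‖f z‖ ≤ C * ((1 + ‖z.fst‖) ^ (-a) * (1 + ‖z.snd‖) ^ (-b)) := by
  obtain ⟨n, hn⟩ := exists_nat_ge (max a b)
  refine ⟨2 ^ (n + n) * ((Finset.Iic (n + n, 0)).sup fun m => SchwartzMap.seminorm ℝ m.1 m.2) f,
    fun z => ?_⟩
  have hdecay := SchwartzMap.one_add_le_sup_seminorm_apply (𝕜 := ℝ) (m := (n + n, 0))
    (k := n + n) (n := 0) le_rfl le_rfl f z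
  rw [norm_iteratedFDeriv_zero] at hdecay
  have hpow {t e : ℝ} (ht₀ : 0 ≤ t) (ht : t ≤ ‖z‖) (he : e ≤ n) :
      (1 + t) ^ e ≤ (1 + ‖z‖) ^ n := by
    rw [← Real.rpow_natCast]
    exact (Real.rpow_le_rpow_of_exponent_le (by linarith) he).trans
      (Real.rpow_le_rpow (by positivity) (by linarith) (by positivity))
  rw [Real.rpow_neg (by positivity), Real.rpow_neg (by positivity), ← mul_inv, ← div_eq_mul_inv,
    le_div_iff₀ (by positivity), mul_comm]
  refine le_trans ?_ hdecay
  rw [pow_add]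
  gcongr
  · exact hpow (norm_nonneg _) (WithLp.norm_fst_le _ z) ((le_max_left a b).trans hn)
  · exact hpow (norm_nonneg _) (WithLp.norm_snd_le _ z) ((le_max_right a b).trans hn)

theorem phaseWeight_le_mul_rpow (hα : 0 ≤ α) (hk : 0 ≤ k) (hl : 0 ≤ l) (z : Phase d) :
    phaseWeight α k l z ≤ 2 ^ k * 2 ^ l * ((1 + ‖z.fst‖) ^ k * (1 + ‖z.snd‖) ^ l) := by
  rw [mul_mul_mul_comm, ← Real.mul_rpow zero_le_two (by positivity),
    ← Real.mul_rpow zero_le_two (by positivity)]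
  exact mul_le_mul (polyWeight_le_two_mul_rpow (by linarith) hk _)
    (polyWeight_le_two_mul_rpow le_rfl hl _) (polyWeight_nonneg _ _ _) (by positivity)

theorem exists_enorm_phaseWeight_mul_schwartz_le {E : Type*} [NormedAddCommGroup E]
    [NormedSpace ℝ E] (hα : 0 ≤ α) (hk : 0 ≤ k) (hl : 0 ≤ l) (f : 𝓢(Phase d, E)) (s t : ℝ) :
    ∃ C : ℝ, ∀ z, ‖phaseWeight α k l z‖ₑ * ‖f z‖ₑ ≤
      ‖C‖ₑ * (‖(1 + ‖z.fst‖) ^ (-s)‖ₑ * ‖(1 + ‖z.snd‖) ^ (-t)‖ₑ) := by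
  obtain ⟨C, hC⟩ := exists_norm_schwartz_le f (k + s) (l + t)
  refine ⟨2 ^ k * 2 ^ l * C, fun z => ?_⟩
  rw [← enorm_norm (f z), ← enorm_mul, ← enorm_mul, ← enorm_mul,
    Real.enorm_of_nonneg (mul_nonneg (phaseWeight_nonneg _ _ _ _) (norm_nonneg _))]
  refine (ENNReal.ofReal_le_ofReal ?_).trans (Real.ofReal_le_enorm _)
  refine (mul_le_mul (phaseWeight_le_mul_rpow hα hk hl z) (hC z) (norm_nonneg _)
    (by positivity)).trans_eq ?_
  rw [neg_add, neg_add, Real.rpow_add (by positivity), Real.rpow_add (by positivity),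
    Real.rpow_neg (by positivity) k, Real.rpow_neg (by positivity) l]
  field_simp

theorem weightedNorm_schwartz_lt_top {E : Type*} [NormedAddCommGroup E] [NormedSpace ℝ E]
    (hα : 0 ≤ α) (hk : 0 ≤ k) (hl : 0 ≤ l) (h₁ : p.1 ≠ 0) (h₁' : p.1 ≠ ∞) (h₂ : p.2 ≠ 0)
    (h₂' : p.2 ≠ ∞) (f : 𝓢(Phase d, E)) : weightedNorm α k l p f < ∞ := by
  let decay (r : ℝ≥0∞) (x : EuclideanSpace ℝ (Fin d)) : ℝ := (1 + ‖x‖) ^ (-(d / r.toReal + 1))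
  have hmeas (r : ℝ≥0∞) : Measurable fun x => ‖decay r x‖ₑ := by fun_prop
  have hfin {r : ℝ≥0∞} (hr : r ≠ 0) (hr' : r ≠ ∞) : eLpNorm (decay r) r volume < ∞ := by
    have hr₀ : 0 < r.toReal := ENNReal.toReal_pos hr hr'
    refine eLpNorm_one_add_norm_rpow_lt_top hr hr' ?_
    rw [finrank_euclideanSpace_fin, add_mul, div_mul_cancel₀ _ hr₀.ne']
    linarith
  obtain ⟨C, hC⟩ := exists_enorm_phaseWeight_mul_schwartz_le hα hk hl f (d / p.1.toReal + 1)
    (d / p.2.toReal + 1)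
  calc weightedNorm α k l p f
      ≤ mixedLpNorm p volume volume fun z => ‖C‖ₑ * (‖decay p.1 z.1‖ₑ * ‖decay p.2 z.2‖ₑ) :=
        mixedLpNorm_mono_enorm fun z => hC (WithLp.toLp 2 z)
    _ = ‖C‖ₑ * (eLpNorm (fun x => ‖decay p.1 x‖ₑ) p.1 volume *
          eLpNorm (fun v => ‖decay p.2 v‖ₑ) p.2 volume) :=
        mixedLpNorm_mul (f := fun x => ‖decay p.1 x‖ₑ) (g := fun v => ‖decay p.2 v‖ₑ) _
          (hmeas p.1) (hmeas p.2)
    _ < ∞ := by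
        rw [eLpNorm_enorm, eLpNorm_enorm]
        exact ENNReal.mul_lt_top enorm_lt_top (ENNReal.mul_lt_top (hfin h₁ h₁') (hfin h₂ h₂'))

theorem weightedNorm_dilate_le (hα : 0 ≤ α) (hk : 0 ≤ k) (hl : 0 ≤ l) (h₁ : p.1 ≠ ∞)
    (h₂ : p.2 ≠ ∞) {lam : ℝ} (hlam : 1 ≤ lam) {φ : Phase d → ℝ} (hφ : Measurable φ) :
    weightedNorm α k l p (dilate α lam φ) ≤
      ENNReal.ofReal (lam ^ gap d α (1, 1) p) * weightedNorm α k l p φ := by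
  have hpos : 0 < lam := by linarith
  set G : EuclideanSpace ℝ (Fin d) × EuclideanSpace ℝ (Fin d) → ℝ≥0∞ :=
    fun z => ‖phaseWeight α k l (WithLp.toLp 2 z)‖ₑ * ‖φ (WithLp.toLp 2 z)‖ₑ
  have hG : Measurable G :=
    (measurable_enorm_phaseWeight_mul hα hφ).comp (WithLp.measurable_toLp _ _)
  have hG' : Measurable fun z : EuclideanSpace ℝ (Fin d) × EuclideanSpace ℝ (Fin d) =>
      G (lam ^ (1 + α) • z.1, lam • z.2) := hG.comp (by fun_prop)
  have hexp : lam ^ gap d α (1, 1) p = lam ^ ((2 + α) * (d : ℝ)) *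
      ((lam ^ (1 + α)) ^ (-(d * (p.1⁻¹).toReal)) * lam ^ (-(d * (p.2⁻¹).toReal))) := by
    rw [← Real.rpow_mul hpos.le, ← Real.rpow_add hpos, ← Real.rpow_add hpos, gap]
    congr 1
    simp only [inv_one, ENNReal.toReal_one]
    ring
  calc weightedNorm α k l p (dilate α lam φ)
      ≤ mixedLpNorm p volume volume fun z => ENNReal.ofReal (lam ^ ((2 + α) * (d : ℝ))) *
          G (lam ^ (1 + α) • z.1, lam • z.2) := by
        refine mixedLpNorm_mono_enorm fun z => ?_
        have hw := enorm_phaseWeight_le_scale hα hk hl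
          (Real.one_le_rpow hlam (by linarith : 0 ≤ 1 + α)) hlam (WithLp.toLp 2 z)
        have hc : 0 ≤ lam ^ ((2 + α) * (d : ℝ)) := by positivity
        rw [enorm_eq_self, enorm_eq_self, dilate, enorm_mul, Real.enorm_of_nonneg hc,
          mul_left_comm]
        exact mul_le_mul_right (mul_le_mul_left hw _) _
    _ = ENNReal.ofReal (lam ^ gap d α (1, 1) p) * weightedNorm α k l p φ := by
        rw [mixedLpNorm_const_mul h₁ _ hG', mixedLpNorm_comp_smul h₁ h₂ (by positivity) hpos hG,
          ← mul_assoc, ← ENNReal.ofReal_mul (by positivity), finrank_euclideanSpace_fin, ← hexp]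
        rfl

theorem anorm_nonneg (α : ℝ) (z : Phase d) : 0 ≤ anorm α z := by
  unfold anorm
  positivity

theorem one_add_rpow_le {a e : ℝ} (ha : 0 ≤ a) (he : 0 ≤ e) :
    (1 + a) ^ e ≤ 2 ^ e * (1 + a ^ e) := by
  calc (1 + a) ^ e ≤ (2 * max 1 a) ^ e := by
        refine Real.rpow_le_rpow (by positivity) ?_ he
        linarith [le_max_left 1 a, le_max_right 1 a]
    _ = 2 ^ e * max 1 a ^ e := Real.mul_rpow zero_le_two (by positivity)
    _ ≤ 2 ^ e * (1 + a ^ e) := by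
        gcongr
        rcases max_cases 1 a with ⟨h, -⟩ | ⟨h, -⟩ <;> rw [h]
        · simpa using Real.rpow_nonneg ha e
        · simp

theorem phaseWeight_le_rpow_anorm (hk : 0 ≤ k) (hl : 0 ≤ l) (z : Phase d) :
    phaseWeight α k l z ≤ (1 + anorm α z) ^ (k + l) := by
  have hx : 0 ≤ ‖z.fst‖ ^ (1 / (1 + α)) := by positivity
  rw [Real.rpow_add (by linarith [anorm_nonneg α z]), phaseWeight, polyWeight, polyWeight, anorm,
    div_one, Real.rpow_one]
  gcongr
  · linarith [norm_nonneg z.snd]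
  · linarith

theorem eLpNorm_phaseWeight_le {m : ℝ≥0∞} (hm : m ≠ 0) (hm' : m ≠ ∞) (hk : 0 ≤ k) (hl : 0 ≤ l)
    (μ : Measure (Phase d)) [IsProbabilityMeasure μ]
    (hμ : Integrable (fun z => anorm α z ^ ((k + l) * m.toReal)) μ) :
    eLpNorm (phaseWeight α k l) m μ ≤ ENNReal.ofReal (2 ^ (k + l) *
      (1 + ∫ z, anorm α z ^ ((k + l) * m.toReal) ∂μ) ^ (1 / m.toReal)) := by
  have hm₀ : 0 < m.toReal := ENNReal.toReal_pos hm hm'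
  set e := (k + l) * m.toReal with he
  have he₀ : 0 ≤ e := by positivity
  have hmom (z : Phase d) : 0 ≤ anorm α z ^ e := Real.rpow_nonneg (anorm_nonneg α z) e
  have hpt (z : Phase d) :
      ‖phaseWeight α k l z‖ₑ ^ m.toReal ≤ ENNReal.ofReal (2 ^ e * (1 + anorm α z ^ e)) := by
    have hz := anorm_nonneg α z
    rw [Real.enorm_of_nonneg (phaseWeight_nonneg _ _ _ _),
      ENNReal.ofReal_rpow_of_nonneg (phaseWeight_nonneg _ _ _ _) hm₀.le]
    refine ENNReal.ofReal_le_ofReal (le_trans ?_ (one_add_rpow_le hz he₀))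
    rw [he, Real.rpow_mul (by linarith)]
    exact Real.rpow_le_rpow (phaseWeight_nonneg _ _ _ _) (phaseWeight_le_rpow_anorm hk hl z) hm₀.le
  have hint : ∫⁻ z, ‖phaseWeight α k l z‖ₑ ^ m.toReal ∂μ ≤
      ENNReal.ofReal (2 ^ e * (1 + ∫ z, anorm α z ^ e ∂μ)) := by
    have hμ' : Integrable (fun z => 1 + anorm α z ^ e) μ := (integrable_const 1).add hμ
    refine (lintegral_mono hpt).trans_eq ?_
    rw [← ofReal_integral_eq_lintegral_ofReal (hμ'.const_mul _)
      (.of_forall fun z => mul_nonneg (by positivity) (add_nonneg zero_le_one (hmom z))),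
      integral_const_mul, integral_add (integrable_const 1) hμ, integral_const, probReal_univ,
      one_smul]
  have hI : 0 ≤ ∫ z, anorm α z ^ e ∂μ := integral_nonneg hmom
  rw [eLpNorm_eq_lintegral_rpow_enorm_toReal hm hm']
  refine (ENNReal.rpow_le_rpow hint (by positivity)).trans_eq ?_
  rw [ENNReal.ofReal_rpow_of_nonneg (by positivity) (by positivity),
    Real.mul_rpow (by positivity) (by positivity), ← Real.rpow_mul zero_le_two, he, mul_assoc,
    mul_one_div_cancel hm₀.ne', mul_one]

end SchwartzWeight

section Kernel

open scoped Convolution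

variable {d : ℕ} {α k l : ℝ} {p : ℝ≥0∞ × ℝ≥0∞}

theorem norm_convolution_le_of_norm_le {G E E' F : Type*} [AddGroup G] [MeasurableSpace G]
    {μ : Measure G} [NormedAddCommGroup E] [NormedSpace ℝ E] [NormedAddCommGroup E']
    [NormedSpace ℝ E'] [NormedAddCommGroup F] [NormedSpace ℝ F] (L : E →L[ℝ] E' →L[ℝ] F)
    {g : G → E} {f : G → E'} {K : ℝ} (hg : Integrable g μ) (hK : ∀ z, ‖f z‖ ≤ K) (z : G) :
    ‖(g ⋆[L, μ] f) z‖ ≤ ∫ u, ‖L‖ * ‖g u‖ * K ∂μ :=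
  norm_integral_le_of_norm_le ((hg.norm.const_mul _).mul_const K) <|
    .of_forall fun u => (L.le_opNorm₂ _ _).trans (by gcongr; exact hK _)

theorem weightedNorm_convolution_le {E E' F : Type*} [NormedAddCommGroup E] [NormedSpace ℝ E]
    [MeasurableSpace E] [OpensMeasurableSpace E] [NormedAddCommGroup E'] [NormedSpace ℝ E']
    [MeasurableSpace E'] [OpensMeasurableSpace E'] [NormedAddCommGroup F] [NormedSpace ℝ F]
    (hα : 0 ≤ α) (hk : 0 ≤ k) (hl : 0 ≤ l) (h₁ : 1 ≤ p.1) (h₂ : 1 ≤ p.2) (h₁' : p.1 ≠ ∞)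
    (h₂' : p.2 ≠ ∞) (L : E →L[ℝ] E' →L[ℝ] F) {g : Phase d → E} {f : Phase d → E'}
    (hg : Measurable g) (hf : Measurable f) :
    weightedNorm α k l p (g ⋆[L, volume] f) ≤
      ‖L‖ₑ * weightedNorm α k l (1, 1) g * weightedNorm α k l p f := by
  have hw (u : Phase d) : Measurable fun z : EuclideanSpace ℝ (Fin d) × EuclideanSpace ℝ (Fin d) =>
      ‖phaseWeight α k l (WithLp.toLp 2 z)‖ₑ * ‖f (WithLp.toLp 2 z - u)‖ₑ :=
    (measurable_enorm_phaseWeight_mul hα (hf.comp (measurable_id.sub_const u))).comp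
      (WithLp.measurable_toLp _ _)
  calc weightedNorm α k l p (g ⋆[L, volume] f)
      ≤ mixedLpNorm p volume volume fun z => ∫⁻ u, ‖L‖ₑ * ‖g u‖ₑ *
          (‖phaseWeight α k l (WithLp.toLp 2 z)‖ₑ * ‖f (WithLp.toLp 2 z - u)‖ₑ) := by
        refine mixedLpNorm_mono_enorm fun z => ?_
        simp only [enorm_eq_self]
        refine (mul_le_mul_right (enorm_integral_le_lintegral_enorm _) _).trans ?_
        rw [← lintegral_const_mul' _ _ enorm_ne_top]
        refine lintegral_mono fun u => ?_
        rw [mul_left_comm]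
        exact mul_le_mul_right (L.le_opENorm₂ _ _) _
    _ ≤ ∫⁻ u, mixedLpNorm p volume volume fun z => ‖L‖ₑ * ‖g u‖ₑ *
          (‖phaseWeight α k l (WithLp.toLp 2 z)‖ₑ * ‖f (WithLp.toLp 2 z - u)‖ₑ) := by
        have hz : Measurable fun y : (EuclideanSpace ℝ (Fin d) × EuclideanSpace ℝ (Fin d)) ×
            Phase d => (WithLp.toLp 2 y.1 : Phase d) :=
          (WithLp.measurable_toLp _ _).comp measurable_fst
        exact mixedLpNorm_lintegral_le h₁ h₂ h₁' h₂' <|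
          ((hg.comp measurable_snd).enorm.const_mul _).mul <|
            ((continuous_phaseWeight hα).measurable.comp hz).enorm.mul
              (hf.comp (hz.sub measurable_snd)).enorm
    _ ≤ ∫⁻ u, ‖L‖ₑ * ‖g u‖ₑ * (‖phaseWeight α k l u‖ₑ * weightedNorm α k l p f) := by
        refine lintegral_mono fun u => ?_
        rw [mixedLpNorm_const_mul h₁' _ (hw u)]
        exact mul_le_mul_right (weightedNorm_comp_sub_le hα hk hl h₁' hf u) _
    _ = ‖L‖ₑ * weightedNorm α k l (1, 1) g * weightedNorm α k l p f := by
        have hg' := measurable_enorm_phaseWeight_mul (k := k) (l := l) hα hg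
        rw [weightedNorm_one hα hg, ← lintegral_const_mul _ hg',
          ← lintegral_mul_const _ (hg'.const_mul _)]
        exact lintegral_congr fun u => by ring

theorem integrable_conv_smul_and_integral_eq {g : Phase d → ℂ} {f : Phase d → ℝ} {K : ℝ}
    (hg : Integrable g) (hf : Continuous f) (hK : ∀ z, ‖f z‖ ≤ K) (ν : Measure (Phase d))
    [IsFiniteMeasure ν] (z : Phase d) :
    Integrable (fun u => conv f ν (z - u) • g u) ∧ ∫ u, conv f ν (z - u) • g u =
      ∫ y, (g ⋆[(ContinuousLinearMap.lsmul ℝ ℝ).flip, volume] f) (z - y) ∂ν := by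
  have hi : Integrable (fun w : Phase d × Phase d => f (z - w.1 - w.2) • g w.1)
      (volume.prod ν) :=
    (hg.comp_fst ν).bdd_smul K (hf.comp (by fun_prop)).aestronglyMeasurable
      (.of_forall fun w => hK _)
  have hsmul (u : Phase d) : conv f ν (z - u) • g u = ∫ y, f (z - u - y) • g u ∂ν :=
    (integral_smul_const _ _).symm
  simp only [hsmul]
  refine ⟨hi.integral_prod_left, ?_⟩
  rw [integral_integral_swap hi]
  simp only [convolution_def, ContinuousLinearMap.flip_apply, ContinuousLinearMap.lsmul_apply,
    sub_right_comm z]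

theorem continuous_dilate (α lam : ℝ) {φ : Phase d → ℝ} (hφ : Continuous φ) :
    Continuous (dilate α lam φ) := by
  unfold dilate
  fun_prop

theorem exists_norm_dilate_le (α lam : ℝ) (φ : 𝓢(Phase d, ℝ)) :
    ∃ K, ∀ z, ‖dilate α lam φ z‖ ≤ K := by
  obtain ⟨K, -, hK⟩ := φ.decay 0 0
  refine ⟨‖lam ^ ((2 + α) * (d : ℝ))‖ * K, fun z => ?_⟩
  rw [dilate, norm_mul]
  gcongr
  simpa using hK (WithLp.toLp 2 (lam ^ (1 + α) • z.fst, lam • z.snd))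

/-- The kernel `φ̌_j * φ_λ`, through which the block `ℛ_j` acts on measures mollified by `φ_λ`. -/
def Cutoff.blockKernel (χ : Cutoff d α) (j : ℕ) (lam : ℝ) (φ : Phase d → ℝ) : Phase d → ℂ :=
  invFourier (χ.piece j) ⋆[(ContinuousLinearMap.lsmul ℝ ℝ).flip, volume] dilate α lam φ

theorem block_mollifiedDiff (χ : Cutoff d α) (j : ℕ) (lam : ℝ) (φ : 𝓢(Phase d, ℝ))
    (ν μ : Measure (Phase d)) [IsFiniteMeasure ν] [IsFiniteMeasure μ] (z : Phase d) :
    χ.block j (mollifiedDiff α lam φ ν μ) z =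
      ∫ y, χ.blockKernel j lam φ (z - y) ∂ν - ∫ y, χ.blockKernel j lam φ (z - y) ∂μ := by
  obtain ⟨K, hK⟩ := exists_norm_dilate_le α lam φ
  have : (volume : Measure (Phase d)).IsNegInvariant :=
    ⟨(LinearIsometryEquiv.neg ℝ (E := Phase d)).measurePreserving.map_eq⟩
  set g := invFourier (χ.piece j)
  have hφ := continuous_dilate α lam φ.continuous
  obtain ⟨hν, hν'⟩ := integrable_conv_smul_and_integral_eq g.integrable hφ hK ν z
  obtain ⟨hμ, hμ'⟩ := integrable_conv_smul_and_integral_eq g.integrable hφ hK μ z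
  unfold Cutoff.blockKernel
  rw [← hν', ← hμ', ← integral_sub hν hμ, Cutoff.block, mollifiedDiff,
    Lp.toTemperedDistribution_apply]
  refine Eq.trans (integral_congr_ae ?_) (integral_sub_left_eq_self (fun u =>
    conv (dilate α lam φ) ν (z - u) • g u - conv (dilate α lam φ) μ (z - u) • g u) volume z)
  filter_upwards [(((memLp_conv α lam φ ν).sub (memLp_conv α lam φ μ)).ofReal
    (K := ℂ)).coeFn_toLp] with u hu
  refine (congrArg _ hu).trans ?_
  change reflectAt g z u •
    ((conv (dilate α lam φ) ν u - conv (dilate α lam φ) μ u : ℝ) : ℂ) = _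
  simp only [reflectAt, SchwartzMap.compSubConstCLM_apply,
    SchwartzMap.compCLMOfContinuousLinearEquiv_apply, Function.comp_apply,
    ContinuousLinearEquiv.neg_apply, neg_sub, sub_sub_cancel, smul_eq_mul, Complex.real_smul]
  push_cast
  ring

theorem continuous_blockKernel (χ : Cutoff d α) (j : ℕ) (lam : ℝ) (φ : 𝓢(Phase d, ℝ)) :
    Continuous (χ.blockKernel j lam φ) := by
  obtain ⟨K, hK⟩ := exists_norm_dilate_le α lam φ
  exact BddAbove.continuous_convolution_right_of_integrable _
    ⟨K, Set.forall_mem_range.2 hK⟩ (SchwartzMap.integrable _) (continuous_dilate α lam φ.continuous)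

theorem exists_norm_blockKernel_le (χ : Cutoff d α) (j : ℕ) (lam : ℝ) (φ : 𝓢(Phase d, ℝ)) :
    ∃ K, ∀ z, ‖χ.blockKernel j lam φ z‖ ≤ K := by
  obtain ⟨K, hK⟩ := exists_norm_dilate_le α lam φ
  exact ⟨_, norm_convolution_le_of_norm_le _ (SchwartzMap.integrable _) hK⟩

theorem invFourier_sub (f g : 𝓢(Phase d, ℝ)) :
    invFourier (f - g) = invFourier f - invFourier g := by
  simp only [invFourier, map_sub]
  exact map_sub (FourierTransform.fourierInvCLM ℂ 𝓢(Phase d, ℂ)) _ _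

theorem inner_scaleBy {s t : ℝ} (hs : s ≠ 0) (ht : t ≠ 0) (z w : Phase d) :
    inner ℝ (scaleBy d s t hs ht z) w = inner ℝ z (scaleBy d s t hs ht w) := by
  simp only [WithLp.prod_inner_apply]
  change inner ℝ (s • z.fst) w.fst + inner ℝ (t • z.snd) w.snd =
    inner ℝ z.fst (s • w.fst) + inner ℝ z.snd (t • w.snd)
  simp only [real_inner_smul_left, real_inner_smul_right]

theorem map_scaleBy_volume {s t : ℝ} (hs : s ≠ 0) (ht : t ≠ 0) :
    Measure.map (scaleBy d s t hs ht) volume =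
      ENNReal.ofReal |(scaleBy d s t hs ht : Phase d →L[ℝ] Phase d).det⁻¹| • volume :=
  Measure.map_linearMap_addHaar_eq_smul_addHaar volume
    (scaleBy d s t hs ht).toLinearEquiv.isUnit_det'.ne_zero

theorem invFourier_comp_scaleBy {s t : ℝ} (hs : s ≠ 0) (ht : t ≠ 0) (g : 𝓢(Phase d, ℝ))
    (z : Phase d) :
    invFourier (SchwartzMap.compCLMOfContinuousLinearEquiv ℝ (scaleBy d s t hs ht) g) z =
      |(scaleBy d s t hs ht : Phase d →L[ℝ] Phase d).det⁻¹| •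
        invFourier g ((scaleBy d s t hs ht).symm z) := by
  have hinner (ξ : Phase d) : (inner ℝ ξ z : ℝ) =
      inner ℝ (scaleBy d s t hs ht ξ) ((scaleBy d s t hs ht).symm z) := by
    rw [inner_scaleBy, ContinuousLinearEquiv.apply_symm_apply]
  have hcov := (scaleBy d s t hs ht).toHomeomorph.measurableEmbedding.integral_map (μ := volume)
    fun ξ => Complex.exp (Complex.I * (inner ℝ ξ ((scaleBy d s t hs ht).symm z) : ℝ)) * (g ξ : ℂ)
  rw [ContinuousLinearEquiv.coe_toHomeomorph, map_scaleBy_volume, integral_smul_measure,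
    ENNReal.toReal_ofReal (abs_nonneg _)] at hcov
  simp only [invFourier_apply, SchwartzMap.compCLMOfContinuousLinearEquiv_apply,
    Function.comp_apply, hinner]
  rw [← hcov, smul_comm]

theorem weightedNorm_invFourier_comp_scaleBy_le (hα : 0 ≤ α) (hk : 0 ≤ k) (hl : 0 ≤ l) {s t : ℝ}
    (hs : 0 < s) (ht : 0 < t) (hs' : s ≤ 1) (ht' : t ≤ 1) (g : 𝓢(Phase d, ℝ)) :
    weightedNorm α k l (1, 1) (invFourier (SchwartzMap.compCLMOfContinuousLinearEquiv ℝ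
      (scaleBy d s t hs.ne' ht.ne') g)) ≤ weightedNorm α k l (1, 1) (invFourier g) := by
  set S := scaleBy d s t hs.ne' ht.ne' with hS
  have hw (z : Phase d) : ‖phaseWeight α k l z‖ₑ ≤ ‖phaseWeight α k l (S.symm z)‖ₑ :=
    enorm_phaseWeight_le_scale hα hk hl ((one_le_inv₀ hs).2 hs') ((one_le_inv₀ ht).2 ht') z
  rw [weightedNorm_one hα (SchwartzMap.continuous _).measurable,
    weightedNorm_one hα (SchwartzMap.continuous _).measurable]
  calc ∫⁻ z, ‖phaseWeight α k l z‖ₑ * ‖invFourier (SchwartzMap.compCLMOfContinuousLinearEquiv ℝ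
          S g) z‖ₑ
      ≤ ∫⁻ z, ‖phaseWeight α k l (S.symm z)‖ₑ * ‖invFourier g (S.symm z)‖ₑ
          ∂(ENNReal.ofReal |(S : Phase d →L[ℝ] Phase d).det⁻¹| • volume) := by
        rw [lintegral_smul_measure, smul_eq_mul, ← lintegral_const_mul' _ _ ENNReal.ofReal_ne_top]
        refine lintegral_mono fun z => ?_
        rw [hS, invFourier_comp_scaleBy, enorm_smul, Real.enorm_of_nonneg (abs_nonneg _),
          mul_left_comm]
        exact mul_le_mul_right (mul_le_mul_left (hw z) _) _
    _ = ∫⁻ z, ‖phaseWeight α k l z‖ₑ * ‖invFourier g z‖ₑ := by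
        have hSm : MeasurableEmbedding S := S.toHomeomorph.measurableEmbedding
        rw [hS, ← map_scaleBy_volume, ← hS, hSm.lintegral_map]
        simp only [ContinuousLinearEquiv.symm_apply_apply]

theorem weightedNorm_sub_one_le {E : Type*} [NormedAddCommGroup E] [MeasurableSpace E]
    [OpensMeasurableSpace E] [MeasurableSub₂ E] (hα : 0 ≤ α) {f g : Phase d → E}
    (hf : Measurable f) (hg : Measurable g) :
    weightedNorm α k l (1, 1) (f - g) ≤
      weightedNorm α k l (1, 1) f + weightedNorm α k l (1, 1) g := by
  rw [weightedNorm_one hα hf, weightedNorm_one hα hg, weightedNorm_one hα (hf.sub hg),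
    ← lintegral_add_left (measurable_enorm_phaseWeight_mul hα hf)]
  refine lintegral_mono fun z => ?_
  rw [← mul_add]
  exact mul_le_mul_right enorm_sub_le _

theorem weightedNorm_invFourier_piece_le (hα : 0 ≤ α) (hk : 0 ≤ k) (hl : 0 ≤ l)
    (χ : Cutoff d α) (j : ℕ) :
    weightedNorm α k l (1, 1) (invFourier (χ.piece j)) ≤
      2 * weightedNorm α k l (1, 1) (invFourier χ.fn) := by
  have hscale (s : ℝ) (hs : s ≤ 0) : weightedNorm α k l (1, 1) (invFourier
      (SchwartzMap.compCLMOfContinuousLinearEquiv ℝ (dyadicScale d α s) χ.fn)) ≤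
        weightedNorm α k l (1, 1) (invFourier χ.fn) :=
    weightedNorm_invFourier_comp_scaleBy_le hα hk hl (by positivity) (by positivity)
      (Real.rpow_le_one_of_one_le_of_nonpos one_le_two
        (mul_nonpos_of_nonneg_of_nonpos (by linarith) hs))
      (Real.rpow_le_one_of_one_le_of_nonpos one_le_two hs) χ.fn
  cases j with
  | zero => exact le_mul_of_one_le_left zero_le one_le_two
  | succ i =>
    have hmeas (f : 𝓢(Phase d, ℂ)) : Measurable f := f.continuous.measurable
    rw [Cutoff.piece, invFourier_sub, two_mul]
    exact (weightedNorm_sub_one_le hα (hmeas _) (hmeas _)).trans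
      (add_le_add (hscale _ (by linarith)) (hscale _ (by linarith)))

theorem exists_weightedNorm_blockKernel_le (hα : 0 ≤ α) (hk : 0 ≤ k) (hl : 0 ≤ l)
    (h₁ : 1 ≤ p.1) (h₂ : 1 ≤ p.2) (h₁' : p.1 ≠ ∞) (h₂' : p.2 ≠ ∞) (χ : Cutoff d α)
    (φ : 𝓢(Phase d, ℝ)) :
    ∃ C : ℝ≥0∞, C ≠ ∞ ∧ ∀ (j : ℕ) (lam : ℝ), 1 ≤ lam →
      weightedNorm α k l p (χ.blockKernel j lam φ) ≤
        C * ENNReal.ofReal (lam ^ gap d α (1, 1) p) := by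
  set L : ℂ →L[ℝ] ℝ →L[ℝ] ℂ := (ContinuousLinearMap.lsmul ℝ ℝ).flip
  have hχ := weightedNorm_schwartz_lt_top (p := (1, 1)) hα hk hl one_ne_zero ENNReal.one_ne_top
    one_ne_zero ENNReal.one_ne_top (invFourier χ.fn)
  have hφ := weightedNorm_schwartz_lt_top hα hk hl (zero_lt_one.trans_le h₁).ne' h₁'
    (zero_lt_one.trans_le h₂).ne' h₂' φ
  refine ⟨‖L‖ₑ * (2 * weightedNorm α k l (1, 1) (invFourier χ.fn)) * weightedNorm α k l p φ,
    by finiteness, fun j lam hlam => ?_⟩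
  refine (weightedNorm_convolution_le hα hk hl h₁ h₂ h₁' h₂' L
    (SchwartzMap.continuous _).measurable
    (continuous_dilate α lam φ.continuous).measurable).trans ?_
  rw [mul_assoc _ (weightedNorm α k l p φ), mul_comm (weightedNorm α k l p φ)]
  gcongr
  · exact weightedNorm_invFourier_piece_le hα hk hl χ j
  · exact weightedNorm_dilate_le hα hk hl h₁' h₂' hlam φ.continuous.measurable

end Kernel

section Empirical

variable {d N : ℕ} {α k l : ℝ} {p : ℝ≥0∞ × ℝ≥0∞}

theorem integral_empirical {E : Type*} [NormedAddCommGroup E] [NormedSpace ℝ E] [CompleteSpace E]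
    {f : Phase d → E} (hf : StronglyMeasurable f) (x : Fin N → Phase d) :
    ∫ y, f y ∂empirical x = (N : ℝ)⁻¹ • ∑ i, f (x i) := by
  rw [empirical, integral_smul_nnreal_measure, integral_finsetSum_measure fun i _ =>
    integrable_dirac' hf enorm_lt_top]
  simp only [integral_dirac' _ _ hf, NNReal.smul_def, NNReal.coe_inv, NNReal.coe_natCast]

theorem block_mollifiedDiff_empirical (χ : Cutoff d α) (j : ℕ) (lam : ℝ) (φ : 𝓢(Phase d, ℝ))
    (hN : N ≠ 0) (x : Fin N → Phase d) (μ : Measure (Phase d)) [IsFiniteMeasure μ] (z : Phase d) :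
    χ.block j (mollifiedDiff α lam φ (empirical x) μ) z = (N : ℝ)⁻¹ • ∑ i,
      (χ.blockKernel j lam φ (z - x i) - ∫ y, χ.blockKernel j lam φ (z - y) ∂μ) := by
  have hH : StronglyMeasurable fun y => χ.blockKernel j lam φ (z - y) :=
    ((continuous_blockKernel χ j lam φ).comp (continuous_sub_left z)).stronglyMeasurable
  rw [block_mollifiedDiff, integral_empirical hH, Finset.sum_sub_distrib, Finset.sum_const,
    Finset.card_univ, Fintype.card_fin, smul_sub, ← Nat.cast_smul_eq_nsmul ℝ,
    inv_smul_smul₀ (Nat.cast_ne_zero.2 hN)]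

theorem stronglyMeasurable_integral_comp_sub {G E : Type*} [MeasurableSpace G] [Sub G]
    [MeasurableSub₂ G] [NormedAddCommGroup E] [NormedSpace ℝ E] {f : G → E}
    (hf : StronglyMeasurable f) (μ : Measure G) [SFinite μ] :
    StronglyMeasurable fun z => ∫ y, f (z - y) ∂μ :=
  (hf.comp_measurable (measurable_fst.sub measurable_snd)).integral_prod_right'

theorem measurable_sum_comp_sub_sub_integral {H : Phase d → ℂ} (hH : Measurable H)
    (μ : Measure (Phase d)) [SFinite μ] :
    Measurable (Function.uncurry fun (z : Phase d) (x : Fin N → Phase d) =>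
      ∑ i, (H (z - x i) - ∫ y, H (z - y) ∂μ)) :=
  Finset.measurable_fun_sum _ fun i _ => (hH.comp (by fun_prop)).sub
    ((stronglyMeasurable_integral_comp_sub hH.stronglyMeasurable μ).measurable.comp measurable_fst)

theorem measurable_block_mollifiedDiff_empirical (χ : Cutoff d α) (j : ℕ) (lam : ℝ)
    (φ : 𝓢(Phase d, ℝ)) (hN : N ≠ 0) (μ : Measure (Phase d)) [IsFiniteMeasure μ] :
    Measurable (Function.uncurry fun (z : Phase d) (x : Fin N → Phase d) =>
      χ.block j (mollifiedDiff α lam φ (empirical x) μ) z) := by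
  simp only [block_mollifiedDiff_empirical χ j lam φ hN]
  have hsum := measurable_sum_comp_sub_sub_integral (N := N)
    (continuous_blockKernel χ j lam φ).measurable μ
  exact hsum.const_smul (N : ℝ)⁻¹

theorem measurable_mixedNorm {Y : Type*} [MeasurableSpace Y] (h₁ : p.1 ≠ ∞) (h₂ : p.2 ≠ ∞)
    {F : Phase d → Y → ℂ} (hF : Measurable (Function.uncurry F)) :
    Measurable fun y => mixedNorm p fun z => F z y :=
  measurable_mixedLpNorm (F := fun z y => F (WithLp.toLp 2 z) y) h₁ h₂ <|
    hF.comp (((WithLp.measurable_toLp 2 _).comp measurable_fst).prodMk measurable_snd)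

theorem measurable_weightedNorm {Y : Type*} [MeasurableSpace Y] (hα : 0 ≤ α) (h₁ : p.1 ≠ ∞)
    (h₂ : p.2 ≠ ∞) {F : Phase d → Y → ℂ} (hF : Measurable (Function.uncurry F)) :
    Measurable fun y => weightedNorm α k l p fun z => F z y := by
  let G (w : Phase d × Y) : ℝ≥0∞ := ‖phaseWeight α k l w.1‖ₑ * ‖F w.1 w.2‖ₑ
  have hG : Measurable G :=
    ((continuous_phaseWeight hα).measurable.comp measurable_fst).enorm.mul hF.enorm
  exact measurable_mixedLpNorm (F := fun z y => G (WithLp.toLp 2 z, y)) h₁ h₂ <|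
    hG.comp (((WithLp.measurable_toLp 2 _).comp measurable_fst).prodMk measurable_snd)

theorem weightedNorm_const_smul (hα : 0 ≤ α) (h₁ : p.1 ≠ ∞) (c : ℝ) {f : Phase d → ℂ}
    (hf : Measurable f) :
    weightedNorm α k l p (fun z => c • f z) = ‖c‖ₑ * weightedNorm α k l p f := by
  simp only [weightedNorm, enorm_smul, mul_left_comm _ ‖c‖ₑ]
  exact mixedLpNorm_const_mul h₁ _
    ((measurable_enorm_phaseWeight_mul hα hf).comp (WithLp.measurable_toLp _ _))

theorem eLpNorm_weightedNorm_sum_comp_sub_le {M : ℕ} {m q : ℝ≥0∞} (hα : 0 ≤ α) (hk : 0 ≤ k)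
    (hl : 0 ≤ l) (hM : M ≠ 0) (hmM : m ≤ M) (h₁M : p.1 ≤ M) (h₂M : p.2 ≤ M) (h₁ : 1 ≤ p.1)
    (h₂ : 1 ≤ p.2) (hm : 1 ≤ m) (hq : q ≠ 0) (hq2 : q ≤ 2) (hq₁ : q ≤ p.1) (hq₂ : q ≤ p.2)
    (hqm : q ≤ m) {H : Phase d → ℂ} (hH : Measurable H) {K : ℝ} (hK : ∀ z, ‖H z‖ ≤ K)
    (μ : Measure (Phase d)) [IsProbabilityMeasure μ] :
    eLpNorm (fun x : Fin N → Phase d => weightedNorm α k l p fun z =>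
        ∑ i, (H (z - x i) - ∫ y, H (z - y) ∂μ)) m (Measure.pi fun _ => μ) ≤
      4 * ENNReal.ofReal (khintchineConst M) * (weightedNorm α k l p H *
        eLpNorm (phaseWeight α k l) m μ * (N : ℝ≥0∞) ^ (1 / q.toReal)) := by
  let D (s : Phase d) (z : EuclideanSpace ℝ (Fin d) × EuclideanSpace ℝ (Fin d)) : ℂ :=
    phaseWeight α k l (WithLp.toLp 2 z) • H (WithLp.toLp 2 z - s)
  have hW := (continuous_phaseWeight (d := d) (k := k) (l := l) hα).measurable
  have hD : Measurable (Function.uncurry D) := by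
    have hz : Measurable fun y : Phase d × (EuclideanSpace ℝ (Fin d) × EuclideanSpace ℝ (Fin d)) =>
        (WithLp.toLp 2 y.2 : Phase d) := (WithLp.measurable_toLp _ _).comp measurable_snd
    exact (hW.comp hz).smul (hH.comp (hz.sub measurable_fst))
  have hint (z : EuclideanSpace ℝ (Fin d) × EuclideanSpace ℝ (Fin d)) :
      Integrable (fun s => D s z) μ :=
    (Integrable.of_bound (hH.comp (measurable_const.sub measurable_id)).aestronglyMeasurable K
      (.of_forall fun _ => hK _)).smul (phaseWeight α k l (WithLp.toLp 2 z))
  have hDW (s : Phase d) :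
      mixedLpNorm p volume volume (D s) ≤ weightedNorm α k l p H * ‖phaseWeight α k l s‖ₑ := by
    rw [mul_comm, ← mixedLpNorm_enorm]
    simp only [D, enorm_smul]
    exact weightedNorm_comp_sub_le hα hk hl (ne_top_of_le_ne_top (by simp) h₁M) hH s
  calc eLpNorm (fun x : Fin N → Phase d => weightedNorm α k l p fun z =>
        ∑ i, (H (z - x i) - ∫ y, H (z - y) ∂μ)) m (Measure.pi fun _ => μ)
      = eLpNorm (fun x : Fin N → Phase d => mixedLpNorm p volume volume fun z =>
          ∑ i, (D (x i) z - ∫ s, D s z ∂μ)) m (Measure.pi fun _ => μ) := by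
        simp only [weightedNorm, D, integral_smul, ← smul_sub, ← Finset.smul_sum, ← enorm_smul,
          mixedLpNorm_enorm]
    _ ≤ 4 * ENNReal.ofReal (khintchineConst M) * eLpNorm (fun _ : Fin N =>
          eLpNorm (fun s => mixedLpNorm p volume volume (D s)) m μ) q Measure.count :=
        eLpNorm_mixedLpNorm_sum_sub_integral_le_count hM hmM h₁M h₂M h₁ h₂ hm hq hq2 hq₁ hq₂ hqm
          (fun _ => hD) fun _ => hint
    _ ≤ 4 * ENNReal.ofReal (khintchineConst M) * (weightedNorm α k l p H *
          eLpNorm (phaseWeight α k l) m μ * (N : ℝ≥0∞) ^ (1 / q.toReal)) := by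
        rw [eLpNorm_const' _ hq (ne_top_of_le_ne_top ENNReal.ofNat_ne_top hq2), enorm_eq_self,
          Measure.count_univ, ENat.card_eq_coe_fintype_card, Fintype.card_fin]
        gcongr
        · rw [← eLpNorm_enorm (phaseWeight α k l),
            ← eLpNorm_const_mul_ennreal _ hW.enorm.aemeasurable]
          exact eLpNorm_mono_enorm hDW
        · simp

theorem eLpNorm_weightedNorm_block_le {M : ℕ} {m q : ℝ≥0∞} (hα : 0 ≤ α) (hk : 0 ≤ k)
    (hl : 0 ≤ l) (hM : M ≠ 0) (hmM : m ≤ M) (h₁M : p.1 ≤ M) (h₂M : p.2 ≤ M) (h₁ : 1 ≤ p.1)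
    (h₂ : 1 ≤ p.2) (hm : 1 ≤ m) (hq : q ≠ 0) (hq2 : q ≤ 2) (hq₁ : q ≤ p.1) (hq₂ : q ≤ p.2)
    (hqm : q ≤ m) (χ : Cutoff d α) (j : ℕ) (lam : ℝ) (φ : 𝓢(Phase d, ℝ)) (hN : N ≠ 0)
    (μ : Measure (Phase d)) [IsProbabilityMeasure μ] :
    eLpNorm (fun x : Fin N → Phase d => weightedNorm α k l p
        (χ.block j (mollifiedDiff α lam φ (empirical x) μ))) m (Measure.pi fun _ => μ) ≤
      4 * ENNReal.ofReal (khintchineConst M) * (weightedNorm α k l p (χ.blockKernel j lam φ) *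
        eLpNorm (phaseWeight α k l) m μ) * ENNReal.ofReal ((N : ℝ) ^ (1 / q.toReal - 1)) := by
  obtain ⟨K, hK⟩ := exists_norm_blockKernel_le χ j lam φ
  have hN' : (0 : ℝ) < N := Nat.cast_pos.2 (Nat.pos_of_ne_zero hN)
  have hH := (continuous_blockKernel χ j lam φ).measurable
  have hS := measurable_sum_comp_sub_sub_integral (N := N) hH μ
  have h₁' : p.1 ≠ ∞ := ne_top_of_le_ne_top (ENNReal.natCast_ne_top M) h₁M
  have h₂' : p.2 ≠ ∞ := ne_top_of_le_ne_top (ENNReal.natCast_ne_top M) h₂M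
  have hpow : ‖(N : ℝ)⁻¹‖ₑ * (N : ℝ≥0∞) ^ (1 / q.toReal) =
      ENNReal.ofReal ((N : ℝ) ^ (1 / q.toReal - 1)) := by
    rw [Real.enorm_of_nonneg (by positivity), ← ENNReal.ofReal_natCast,
      ENNReal.ofReal_rpow_of_pos hN', ← ENNReal.ofReal_mul (by positivity),
      Real.rpow_sub_one hN'.ne', inv_mul_eq_div]
  have hblock (x : Fin N → Phase d) :
      weightedNorm α k l p (χ.block j (mollifiedDiff α lam φ (empirical x) μ)) =
        ‖(N : ℝ)⁻¹‖ₑ * weightedNorm α k l p fun z =>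
          ∑ i, (χ.blockKernel j lam φ (z - x i) - ∫ y, χ.blockKernel j lam φ (z - y) ∂μ) := by
    rw [← weightedNorm_const_smul hα h₁' _ (hS.of_uncurry_right (y := x))]
    exact congrArg _ (funext (block_mollifiedDiff_empirical χ j lam φ hN x μ))
  simp only [hblock]
  rw [eLpNorm_const_mul_ennreal _ (measurable_weightedNorm hα h₁' h₂' hS).aemeasurable, ← hpow]
  refine (mul_le_mul_right (eLpNorm_weightedNorm_sum_comp_sub_le hα hk hl hM hmM h₁M h₂M h₁ h₂
    hm hq hq2 hq₁ hq₂ hqm hH hK μ) _).trans_eq ?_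
  ring

theorem exists_eLpNorm_mixedNorm_block_le {p₁ : ℝ≥0∞ × ℝ≥0∞} {m q : ℝ≥0∞} (hα : 0 ≤ α)
    (hk : 0 ≤ k) (hl : 0 ≤ l) (h₁ : 1 ≤ p₁.1) (h₂ : 1 ≤ p₁.2) (hle₁ : p₁.1 ≤ p.1)
    (hle₂ : p₁.2 ≤ p.2) (hp₁ : p.1 ≠ ∞) (hp₂ : p.2 ≠ ∞)
    (hx : p₁.1 = p.1 ∨ (1 + α) * d * ((p₁.1⁻¹).toReal - (p.1⁻¹).toReal) < k)
    (hv : p₁.2 = p.2 ∨ d * ((p₁.2⁻¹).toReal - (p.2⁻¹).toReal) < l)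
    (hm : 1 ≤ m) (hm' : m ≠ ∞) (hq : q ≠ 0) (hq2 : q ≤ 2) (hq₁ : q ≤ p.1) (hq₂ : q ≤ p.2)
    (hqm : q ≤ m) (χ : Cutoff d α) (φ : 𝓢(Phase d, ℝ)) :
    ∃ C : ℝ≥0∞, C ≠ ∞ ∧ ∀ (μ : Measure (Phase d)) [IsProbabilityMeasure μ] (N : ℕ), N ≠ 0 →
      ∀ lam : ℝ, 1 ≤ lam → ∀ j : ℕ, eLpNorm (fun x : Fin N → Phase d =>
        mixedNorm p₁ (χ.block j (mollifiedDiff α lam φ (empirical x) μ))) m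
          (Measure.pi fun _ => μ) ≤ C * (eLpNorm (phaseWeight α k l) m μ *
            ENNReal.ofReal ((N : ℝ) ^ (1 / q.toReal - 1)) *
              ENNReal.ofReal (lam ^ gap d α (1, 1) p)) := by
  obtain ⟨A, hA, hfA⟩ := exists_mixedNorm_le_weightedNorm hα hk hl (zero_lt_one.trans_le h₁).ne'
    (zero_lt_one.trans_le h₂).ne' hle₁ hle₂ hp₁ hp₂ hx hv
  obtain ⟨B, hB, hkernel⟩ := exists_weightedNorm_blockKernel_le hα hk hl (h₁.trans hle₁)
    (h₂.trans hle₂) hp₁ hp₂ χ φ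
  obtain ⟨M, hM⟩ := ENNReal.exists_nat_gt (max_lt hm'.lt_top (max_lt hp₁.lt_top hp₂.lt_top)).ne
  obtain ⟨hmM, h₁M, h₂M⟩ : m ≤ M ∧ p.1 ≤ M ∧ p.2 ≤ M := by simpa only [max_le_iff] using hM.le
  have hM₀ : M ≠ 0 := by
    rintro rfl
    exact not_lt_zero (by simpa only [Nat.cast_zero] using hM)
  refine ⟨A * (4 * ENNReal.ofReal (khintchineConst M) * B), by finiteness,
    fun μ _ N hN lam hlam j => ?_⟩
  have hblock := measurable_block_mollifiedDiff_empirical χ j lam φ hN μ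
  have hweighted : Measurable fun x : Fin N → Phase d => weightedNorm α k l p
      (χ.block j (mollifiedDiff α lam φ (empirical x) μ)) :=
    measurable_weightedNorm (F := fun z x =>
      χ.block j (mollifiedDiff α lam φ (empirical x) μ) z) hα hp₁ hp₂ hblock
  calc eLpNorm (fun x : Fin N → Phase d =>
        mixedNorm p₁ (χ.block j (mollifiedDiff α lam φ (empirical x) μ))) m (Measure.pi fun _ => μ)
      ≤ A * eLpNorm (fun x : Fin N → Phase d => weightedNorm α k l p
          (χ.block j (mollifiedDiff α lam φ (empirical x) μ))) m (Measure.pi fun _ => μ) := by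
        rw [← eLpNorm_const_mul_ennreal _ hweighted.aemeasurable]
        refine eLpNorm_mono_enorm fun x => ?_
        simp only [enorm_eq_self]
        exact hfA (χ.block j (mollifiedDiff α lam φ (empirical x) μ))
          (hblock.of_uncurry_right (y := x))
    _ ≤ A * (4 * ENNReal.ofReal (khintchineConst M) * (B * ENNReal.ofReal (lam ^ gap d α (1, 1) p) *
          eLpNorm (phaseWeight α k l) m μ) * ENNReal.ofReal ((N : ℝ) ^ (1 / q.toReal - 1))) := by
        grw [eLpNorm_weightedNorm_block_le hα hk hl hM₀ hmM h₁M h₂M (h₁.trans hle₁)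
          (h₂.trans hle₂) hm hq hq2 hq₁ hq₂ hqm χ j lam φ hN μ, hkernel j lam hlam]
    _ = _ := by ring

end Empirical

section Besov

variable {d : ℕ} {α : ℝ} {p : ℝ≥0∞ × ℝ≥0∞}

theorem besovNorm_one_eq_tsum (χ : Cutoff d α) (s : ℝ) (p : ℝ≥0∞ × ℝ≥0∞)
    (f : 𝓢'(Phase d, ℂ)) : χ.besovNorm s 1 p f =
      ∑' j : ℕ, ENNReal.ofReal ((2 : ℝ) ^ ((j : ℝ) * s)) * mixedNorm p (χ.block j f) := by
  rw [Cutoff.besovNorm, eLpNorm_one_eq_lintegral_enorm, lintegral_count]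
  simp only [enorm_eq_self]

theorem tsum_ofReal_two_rpow_ne_top {s : ℝ} (hs : s < 0) :
    ∑' j : ℕ, ENNReal.ofReal ((2 : ℝ) ^ ((j : ℝ) * s)) ≠ ∞ := by
  have hpow (j : ℕ) : ENNReal.ofReal ((2 : ℝ) ^ ((j : ℝ) * s)) = ENNReal.ofReal (2 ^ s) ^ j := by
    rw [← ENNReal.ofReal_pow (by positivity), ← Real.rpow_mul_natCast zero_le_two, mul_comm]
  simp only [hpow]
  rw [ENNReal.tsum_geometric, ENNReal.inv_ne_top]
  exact (tsub_pos_of_lt (ENNReal.ofReal_lt_one.2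
    (Real.rpow_lt_one_of_one_lt_of_neg one_lt_two hs))).ne'

theorem measurable_besovNorm_one {Y : Type*} [MeasurableSpace Y] (χ : Cutoff d α) (s : ℝ)
    {F : Y → 𝓢'(Phase d, ℂ)} (hF : ∀ j, Measurable fun y => mixedNorm p (χ.block j (F y))) :
    Measurable fun y => χ.besovNorm s 1 p (F y) := by
  simp only [besovNorm_one_eq_tsum]
  exact Measurable.tsum fun j => (hF j).const_mul _

theorem eLpNorm_besovNorm_one_le {Y : Type*} [MeasurableSpace Y] {P : Measure Y} [SigmaFinite P]
    {m B : ℝ≥0∞} (hm : 1 ≤ m) (hm' : m ≠ ∞) (χ : Cutoff d α) (s : ℝ) {F : Y → 𝓢'(Phase d, ℂ)}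
    (hF : ∀ j, Measurable fun y => mixedNorm p (χ.block j (F y)))
    (hB : ∀ j, eLpNorm (fun y => mixedNorm p (χ.block j (F y))) m P ≤ B) :
    eLpNorm (fun y => χ.besovNorm s 1 p (F y)) m P ≤
      (∑' j : ℕ, ENNReal.ofReal ((2 : ℝ) ^ ((j : ℝ) * s))) * B := by
  simp only [besovNorm_one_eq_tsum]
  refine (eLpNorm_tsum_le hm hm' fun j => (hF j).const_mul _).trans ?_
  rw [← ENNReal.tsum_mul_right]
  refine ENNReal.tsum_le_tsum fun j => ?_
  rw [eLpNorm_const_mul_ennreal _ (hF j).aemeasurable]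
  exact mul_le_mul_right (hB j) _

theorem exists_add_eq_of_gap_lt {ℓ : ℝ} (hα : 0 ≤ α) {p₁ : ℝ≥0∞ × ℝ≥0∞} (h₁ : p₁.1 ≠ 0)
    (h₂ : p₁.2 ≠ 0) (hx : p₁.1 ≤ p.1) (hv : p₁.2 ≤ p.2)
    (hℓ : (p₁ = p ∧ ℓ = 0) ∨ (p₁ ≠ p ∧ gap d α p₁ p < ℓ)) :
    ∃ k l : ℝ, 0 ≤ k ∧ 0 ≤ l ∧ k + l = ℓ ∧
      (p₁.1 = p.1 ∨ (1 + α) * d * ((p₁.1⁻¹).toReal - (p.1⁻¹).toReal) < k) ∧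
      (p₁.2 = p.2 ∨ d * ((p₁.2⁻¹).toReal - (p.2⁻¹).toReal) < l) := by
  rcases hℓ with ⟨rfl, rfl⟩ | ⟨-, hgap⟩
  · exact ⟨0, 0, le_rfl, le_rfl, add_zero 0, .inl rfl, .inl rfl⟩
  have hinv {r s : ℝ≥0∞} (hr : r ≠ 0) (hrs : r ≤ s) : (s⁻¹).toReal ≤ (r⁻¹).toReal :=
    ENNReal.toReal_mono (ENNReal.inv_ne_top.2 hr) (ENNReal.inv_le_inv.2 hrs)
  set gx := (1 + α) * d * ((p₁.1⁻¹).toReal - (p.1⁻¹).toReal)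
  set gv := d * ((p₁.2⁻¹).toReal - (p.2⁻¹).toReal)
  have hgx : 0 ≤ gx := mul_nonneg (by positivity) (sub_nonneg.2 (hinv h₁ hx))
  have hgv : 0 ≤ gv := mul_nonneg d.cast_nonneg (sub_nonneg.2 (hinv h₂ hv))
  have hgap' : gx + gv < ℓ := hgap
  exact ⟨gx + (ℓ - gx - gv) / 2, gv + (ℓ - gx - gv) / 2, by linarith, by linarith, by ring,
    .inr (by linarith), .inr (by linarith)⟩

theorem exists_eLpNorm_besovNorm_le {p₁ : ℝ≥0∞ × ℝ≥0∞} {m q : ℝ≥0∞} {ℓ β : ℝ} (hα : 0 ≤ α)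
    (h₁ : 1 ≤ p₁.1) (h₂ : 1 ≤ p₁.2) (hle₁ : p₁.1 ≤ p.1)
    (hle₂ : p₁.2 ≤ p.2) (hp₁ : p.1 ≠ ∞) (hp₂ : p.2 ≠ ∞)
    (hℓ : (p₁ = p ∧ ℓ = 0) ∨ (p₁ ≠ p ∧ gap d α p₁ p < ℓ))
    (hm : 1 ≤ m) (hm' : m ≠ ∞) (hq : q ≠ 0) (hq2 : q ≤ 2) (hq₁ : q ≤ p.1) (hq₂ : q ≤ p.2)
    (hqm : q ≤ m) (hβ : β < 0) (χ : Cutoff d α) (φ : 𝓢(Phase d, ℝ)) :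
    ∃ C : ℝ, 0 < C ∧ ∀ (μ : Measure (Phase d)) [IsProbabilityMeasure μ],
      Integrable (fun z => anorm α z ^ (ℓ * m.toReal)) μ → ∀ N : ℕ, N ≠ 0 →
      ∀ lam : ℝ, 1 ≤ lam → eLpNorm (fun x : Fin N → Phase d =>
          χ.besovNorm β 1 p₁ (mollifiedDiff α lam φ (empirical x) μ)) m (Measure.pi fun _ => μ) ≤
        ENNReal.ofReal (C * (1 + ∫ z, anorm α z ^ (ℓ * m.toReal) ∂μ) ^ (1 / m.toReal) *
          (N : ℝ) ^ (1 / q.toReal - 1) * lam ^ gap d α (1, 1) p) := by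
  obtain ⟨k, l, hk, hl, rfl, hx, hv⟩ := exists_add_eq_of_gap_lt hα (zero_lt_one.trans_le h₁).ne'
    (zero_lt_one.trans_le h₂).ne' hle₁ hle₂ hℓ
  obtain ⟨A, hA, hblock⟩ := exists_eLpNorm_mixedNorm_block_le hα hk hl h₁ h₂ hle₁ hle₂ hp₁ hp₂
    hx hv hm hm' hq hq2 hq₁ hq₂ hqm χ φ
  set S := ∑' j : ℕ, ENNReal.ofReal ((2 : ℝ) ^ ((j : ℝ) * β))
  have hSA : S * A ≠ ∞ := ENNReal.mul_ne_top (tsum_ofReal_two_rpow_ne_top hβ) hA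
  refine ⟨((S * A).toReal + 1) * 2 ^ (k + l), by positivity, fun μ _ hμ N hN lam hlam => ?_⟩
  have hmeas (j : ℕ) : Measurable fun x : Fin N → Phase d =>
      mixedNorm p₁ (χ.block j (mollifiedDiff α lam φ (empirical x) μ)) :=
    measurable_mixedNorm (ne_top_of_le_ne_top hp₁ hle₁) (ne_top_of_le_ne_top hp₂ hle₂)
      (measurable_block_mollifiedDiff_empirical χ j lam φ hN μ)
  have hS : S * A ≤ ENNReal.ofReal ((S * A).toReal + 1) :=
    ENNReal.le_ofReal_iff_toReal_le hSA (by positivity) |>.2 (by linarith)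
  have hI : 0 ≤ ∫ z, anorm α z ^ ((k + l) * m.toReal) ∂μ :=
    integral_nonneg fun z => Real.rpow_nonneg (anorm_nonneg α z) _
  calc eLpNorm (fun x : Fin N → Phase d =>
        χ.besovNorm β 1 p₁ (mollifiedDiff α lam φ (empirical x) μ)) m (Measure.pi fun _ => μ)
      ≤ S * (A * (eLpNorm (phaseWeight α k l) m μ *
          ENNReal.ofReal ((N : ℝ) ^ (1 / q.toReal - 1)) *
            ENNReal.ofReal (lam ^ gap d α (1, 1) p))) :=
        eLpNorm_besovNorm_one_le hm hm' χ β hmeas (hblock μ N hN lam hlam)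
    _ ≤ ENNReal.ofReal ((S * A).toReal + 1) * (ENNReal.ofReal (2 ^ (k + l) *
          (1 + ∫ z, anorm α z ^ ((k + l) * m.toReal) ∂μ) ^ (1 / m.toReal)) *
          ENNReal.ofReal ((N : ℝ) ^ (1 / q.toReal - 1)) *
            ENNReal.ofReal (lam ^ gap d α (1, 1) p)) := by
        rw [← mul_assoc S]
        gcongr
        exact eLpNorm_phaseWeight_le (zero_lt_one.trans_le hm).ne' hm' hk hl μ hμ
    _ = _ := by
        rw [← ENNReal.ofReal_mul (by positivity), ← ENNReal.ofReal_mul (by positivity),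
          ← ENNReal.ofReal_mul (by positivity)]
        congr 1
        ring

end Besov

theorem measurePreserving_pi_of_iIndepFun {ι Ω E : Type*} [Fintype ι] [MeasurableSpace Ω]
    [MeasurableSpace E] {P : Measure Ω} [IsProbabilityMeasure P] {μ : Measure E} {ξ : ι → Ω → E}
    (hξ : ∀ i, Measurable (ξ i)) (hind : iIndepFun ξ P) (hlaw : ∀ i, P.map (ξ i) = μ) :
    MeasurePreserving (fun ω i => ξ i ω) P (Measure.pi fun _ => μ) := by
  refine ⟨measurable_pi_lambda _ hξ, ?_⟩
  rw [(iIndepFun_iff_map_fun_eq_pi_map fun i => (hξ i).aemeasurable).1 hind]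
  simp only [hlaw]

end AnisoBesov

end

theorem theoremC3_general {d : ℕ} {α : ℝ} (hα : 0 ≤ α) (χ : Cutoff d α) (φ : 𝓢(Phase d, ℝ))
    (p₁ p : ℝ≥0∞ × ℝ≥0∞) (hp₁x : 1 ≤ p₁.1) (hp₁v : 1 ≤ p₁.2) (hpx : p.1 < ∞) (hpv : p.2 < ∞)
    (hx : p₁.1 ≤ p.1) (hv : p₁.2 ≤ p.2)
    (ℓ : ℝ) (hℓ : (p₁ = p ∧ ℓ = 0) ∨ (p₁ ≠ p ∧ gap d α p₁ p < ℓ))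
    (m : ℝ≥0∞) (hm : 1 ≤ m) (hm' : m < ∞)
    (q : ℝ) (hq : q = (min (min (min p.1 p.2) 2) m).toReal) (β : ℝ) (hβ : β < 0) :
    ∃ C : ℝ, 0 < C ∧
      ∀ (Ω : Type*) [MeasurableSpace Ω] (P : Measure Ω) [IsProbabilityMeasure P]
        (μ : Measure (Phase d)) [IsProbabilityMeasure μ],
        Integrable (fun z => anorm α z ^ (ℓ * m.toReal)) μ →
        ∀ (N : ℕ), 1 ≤ N →
        ∀ (ξ : Fin N → Ω → Phase d),
          (∀ i, Measurable (ξ i)) → iIndepFun ξ P → (∀ i, P.map (ξ i) = μ) →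
        ∀ (lam : ℝ), 1 ≤ lam →
          Measurable (fun ω => χ.besovNorm β 1 p₁
            (mollifiedDiff α lam φ (empirical fun i => ξ i ω) μ)) ∧
          eLpNorm (fun ω => χ.besovNorm β 1 p₁
              (mollifiedDiff α lam φ (empirical fun i => ξ i ω) μ)) m P ≤
            ENNReal.ofReal (C * (1 + ∫ z, anorm α z ^ (ℓ * m.toReal) ∂μ) ^ (1 / m.toReal)
              * (N : ℝ) ^ (1 / q - 1) * lam ^ gap d α (1, 1) p) := by
  subst hq
  have hq : 1 ≤ min (min (min p.1 p.2) 2) m :=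
    le_min (le_min (le_min (hp₁x.trans hx) (hp₁v.trans hv)) one_le_two) hm
  obtain ⟨⟨⟨hq₁, hq₂⟩, hq2⟩, hqm⟩ := by
    simpa only [le_min_iff] using le_refl (min (min (min p.1 p.2) 2) m)
  obtain ⟨C, hC, hbound⟩ := exists_eLpNorm_besovNorm_le hα hp₁x hp₁v hx hv hpx.ne hpv.ne hℓ hm
    hm'.ne (zero_lt_one.trans_le hq).ne' hq2 hq₁ hq₂ hqm hβ χ φ
  refine ⟨C, hC, fun Ω _ P _ μ _ hμ N hN ξ hξ hind hlaw lam hlam => ?_⟩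
  have hN₀ : N ≠ 0 := Nat.one_le_iff_ne_zero.1 hN
  have hsample := measurePreserving_pi_of_iIndepFun hξ hind hlaw
  have hnorm : Measurable fun x : Fin N → Phase d =>
      χ.besovNorm β 1 p₁ (mollifiedDiff α lam φ (empirical x) μ) :=
    measurable_besovNorm_one χ β fun j =>
      measurable_mixedNorm (F := fun z x => χ.block j (mollifiedDiff α lam φ (empirical x) μ) z)
        (hx.trans_lt hpx).ne (hv.trans_lt hpv).ne
        (measurable_block_mollifiedDiff_empirical χ j lam φ hN₀ μ)
  refine ⟨hnorm.comp hsample.measurable, ?_⟩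
  exact (eLpNorm_comp_measurePreserving hnorm.aestronglyMeasurable hsample).trans_le
    (hbound μ hμ N hN₀ lam hlam)

theorem theoremC3 {d : ℕ} (hd : 0 < d) {α : ℝ} (hα : 1 < α) (hα' : α ≤ 2)
    (χ : Cutoff d α) (φ : 𝓢(Phase d, ℝ))
    (p₁ p : ℝ≥0∞ × ℝ≥0∞)
    (hp₁x : 1 ≤ p₁.1) (hp₁v : 1 ≤ p₁.2)
    (hpx : 1 < p.1) (hpv : 1 < p.2) (hpx' : p.1 < ∞) (hpv' : p.2 < ∞)
    (hx : p₁.1 ≤ p.1) (hv : p₁.2 ≤ p.2)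
    (ℓ : ℝ) (hℓ : (p₁ = p ∧ ℓ = 0) ∨ (p₁ ≠ p ∧ gap d α p₁ p < ℓ))
    (q : ℝ) (hq : q = (min (min p.1 p.2) 2).toReal)
    (β : ℝ) (hβ : β < 0) (m : ℕ) (hm : 1 < m) :
    ∃ C : ℝ, 0 < C ∧
      ∀ (Ω : Type*) [MeasurableSpace Ω] (P : Measure Ω) [IsProbabilityMeasure P]
        (μ : Measure (Phase d)) [IsProbabilityMeasure μ],
        Integrable (fun z => anorm α z ^ (ℓ * m)) μ →
        ∀ (N : ℕ), 1 ≤ N →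
        ∀ (ξ : Fin N → Ω → Phase d),
          (∀ i, Measurable (ξ i)) → iIndepFun ξ P → (∀ i, P.map (ξ i) = μ) →
        ∀ (lam : ℝ), 1 ≤ lam →
          Measurable (fun ω => χ.besovNorm β 1 p₁
            (mollifiedDiff α lam φ (empirical fun i => ξ i ω) μ)) ∧
          eLpNorm (fun ω => χ.besovNorm β 1 p₁
              (mollifiedDiff α lam φ (empirical fun i => ξ i ω) μ)) m P ≤
            ENNReal.ofReal (C * (1 + ∫ z, anorm α z ^ (ℓ * m) ∂μ) ^ (1 / (m : ℝ))
              * (N : ℝ) ^ (1 / q - 1) * lam ^ gap d α (1, 1) p) := by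
  have hmin : min (min (min p.1 p.2) 2) (m : ℝ≥0∞) = min (min p.1 p.2) 2 :=
    min_eq_left ((min_le_right _ _).trans (by exact_mod_cast hm))
  simpa only [ENNReal.toReal_natCast] using theoremC3_general (by linarith) χ φ p₁ p hp₁x hp₁v hpx'
    hpv' hx hv ℓ hℓ m (by exact_mod_cast hm.le) (ENNReal.natCast_lt_top m) q (by rw [hmin, hq]) β hβ
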